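/- Let $(E,d)$ be a Polish metric space, let $M_1(E)$ be the set of Borel probability measures on $E$ with the narrow topology (convergence in law), let $\alpha\in M_1(E)$, let $X_1,X_2,\dots$ be i.i.d. $E$-valued random variables with law $\alpha$ on a probability space with probability $\mathbb P$, and let $L_n=\frac1n\sum_{i=1}^n\delta_{X_i}$. Let $H(\beta\mid\alpha)=\int\log\frac{d\beta}{d\alpha}\,d\beta$ be the relative entropy ($+\infty$ if this is not well defined and finite), and $H(C\mid\alpha)=\inf_{\beta\in C}H(\beta\mid\alpha)$. Let $\bar d$ be either the Prohorov metric on $M_1(E)$ or the Fortet–Mourier metric $d_{FM}(\mu,\nu)=\sup\{\int f\,d\mu-\int f\,d\nu:\ \|f\|_\infty+\|f\|_{Lip}\le 1\}$, and put $C^{\varepsilon}=\{\nu\in M_1(E):\inf_{\mu\in C}\bar d(\mu,\nu)\le\varepsilon\}$. For $K\subseteq E$ let $N_E(K,d,\varepsilon)$ be the minimal number of open balls of $E$ of radius $\varepsilon$ that cover $K$. **Theorem 4.8.** Let $C$ be a narrowly closed convex subset of $M_1(E)$ with $H(C\mid\alpha)<\infty$, and let $\alpha^*$ be the $I$-projection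 of $\alpha$ on $C$, that is, the element of $C$ with $H(\alpha^*\mid\alpha)=H(C\mid\alpha)$. Let $(K_n)$ be a sequence of compact subsets of $E$ and $(\eta_n)$ a sequence of nonnegative real numbers with $\eta_n\to0$ such that $$n\eta_n^2+8(\log\eta_n)\,N_E(K_n,d,\eta_n/8)\longrightarrow+\infty .$$ Put $\varepsilon_n=\eta_n+2\alpha^*(K_n^c)$ and $C_n=C^{\varepsilon_n}$. Assume that at least one of the following holds: 1. $\lim_{n\to\infty}\big(\alpha^*(K_n)\big)^n=1$; 2. $\log\frac{d\alpha^*}{d\alpha}$ is continuous and bounded (that is, $\alpha^*=e^h\alpha$ for some bounded continuous $h:E\to\mathbb R$), and $\lim_{n\to\infty}\alpha^*(K_n)=1$. Then, for every integer $k\ge1$, $\mathbb P(L_n\in C_n)>0$ for all $n$ large enough, and the conditional laws $$\alpha^n_{C_n,k}=\mathbb P\big((X_1,\dots,X_k)\in\cdot\ \big|\ L_n\in C_n\big)$$ converge to $\alpha^{*\otimes k}$ in total variation distance as $n\to\infty$. -/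

import Mathlib

open MeasureTheory ProbabilityTheory Filter Topology
open scoped ENNReal NNReal BoundedContinuousFunction

noncomputable section

namespace ThinConstraints

variable {E : Type*}

/-- The relative entropy `H(C | α) = inf {H(β | α) : β ∈ C}` of a set of probability measures,
with values in `[0, ∞]` (it is `∞` when `C` is empty). -/
def relEntropy [MeasurableSpace E] (C : Set (ProbabilityMeasure E)) (α : ProbabilityMeasure E) :
    ℝ≥0∞ :=
  ⨅ β ∈ C, InformationTheory.klDiv (β : Measure E) (α : Measure E)

/-- `αs` is an I-projection of `α` on `C`: it belongs to `C` and attains `H(C | α)`. -/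
def IsIProjection [MeasurableSpace E] (C : Set (ProbabilityMeasure E))
    (α αs : ProbabilityMeasure E) : Prop :=
  αs ∈ C ∧ InformationTheory.klDiv (αs : Measure E) (α : Measure E) = relEntropy C α

/-- Convexity of a set of probability measures. -/
def IsConvexSet [MeasurableSpace E] (C : Set (ProbabilityMeasure E)) : Prop :=
  ∀ μ ∈ C, ∀ ν ∈ C, ∀ a b : ℝ≥0, a + b = 1 → ∀ ρ : ProbabilityMeasure E,
    (ρ : Measure E) = a • (μ : Measure E) + b • (ν : Measure E) → ρ ∈ C

/-- The Prohorov metric between probability measures. -/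
def prohorovDist [MetricSpace E] [MeasurableSpace E] (μ ν : ProbabilityMeasure E) : ℝ :=
  levyProkhorovDist (μ : Measure E) (ν : Measure E)

/-- The unit ball of the bounded Lipschitz functions for the norm `‖f‖_∞ + ‖f‖_Lip`
(both norms being the least constants `a` and `b` below). -/
def bLipUnitBall (E : Type*) [MetricSpace E] : Set (E → ℝ) :=
  {f | ∃ a b : ℝ≥0, a + b ≤ 1 ∧ (∀ x, |f x| ≤ a) ∧ LipschitzWith b f}

/-- The Fortet-Mourier metric between probability measures. -/
def fortetMourierDist [MetricSpace E] [MeasurableSpace E] (μ ν : ProbabilityMeasure E) : ℝ :=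
  ⨆ f : bLipUnitBall E, (∫ x, f.1 x ∂(μ : Measure E) - ∫ x, f.1 x ∂(ν : Measure E))

/-- The enlargement `C^ε = {ν : dbar(C, ν) ≤ ε}`, where `dbar(C, ν)` is the infimum of
`dbar(μ, ν)` over `μ ∈ C`. -/
def enlargement [MeasurableSpace E] (dbar : ProbabilityMeasure E → ProbabilityMeasure E → ℝ)
    (C : Set (ProbabilityMeasure E)) (ε : ℝ) : Set (ProbabilityMeasure E) :=
  {ν | (⨅ μ : C, dbar μ ν) ≤ ε}

/-- The metric entropy `N_E(K, d, ε)`: the least number of open balls of `E` of radius `ε`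
that cover `K` (meaningful when `K` is totally bounded and `ε > 0`). -/
def coveringNumber [MetricSpace E] (K : Set E) (ε : ℝ) : ℕ :=
  sInf {m | ∃ t : Finset E, t.card = m ∧ K ⊆ ⋃ x ∈ t, Metric.ball x ε}

/-- The empirical measure `(1/n) ∑ δ_{x i}` of the first `n` terms of a sequence; a probability
measure for `n ≥ 1`. -/
def empiricalMeasure [MeasurableSpace E] (n : ℕ) (x : ℕ → E) : Measure E :=
  (n : ℝ≥0∞)⁻¹ • ∑ i ∈ Finset.range n, Measure.dirac (x i)

/-- The event `L_n ∈ A`, for the empirical measure `L_n` of the first `n` of the variables `X`. -/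
def empiricalEvent {Ω : Type*} [MeasurableSpace E] (X : ℕ → Ω → E) (n : ℕ)
    (A : Set (ProbabilityMeasure E)) : Set Ω :=
  {ω | ∃ ν ∈ A, (ν : Measure E) = empiricalMeasure n (fun i => X i ω)}

/-- The conditional law of the first `k` of the variables `X` given `L_n ∈ A`. -/
def conditionalLaw {Ω : Type*} [MeasurableSpace Ω] [MeasurableSpace E] (P : Measure Ω)
    (X : ℕ → Ω → E) (n k : ℕ) (A : Set (ProbabilityMeasure E)) : Measure (Fin k → E) :=
  (ProbabilityTheory.cond P (empiricalEvent X n A)).map (fun ω (i : Fin k) => X i ω)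

/-- The total variation distance `sup_B |μ(B) - ν(B)|` of two finite measures. -/
def tvDist {F : Type*} [MeasurableSpace F] (μ ν : Measure F) : ℝ :=
  ⨆ B : {B : Set F // MeasurableSet B}, |μ.real B.1 - ν.real B.1|

end ThinConstraints

end

open ThinConstraints

/-!
The convergence of the conditional laws rests on the comparison of two estimates for the probability
that the empirical measure `L_n` of an i.i.d. sample of law `α` lies in the enlargement `C_n`, whose
radius tends to `0`. Write `H = H(C | α)`.

*Lower bound* (`eventually_neg_log_empirical_le`). Change the measure from `α` to the law `Q` of `αs`
conditioned to stay in the compact set `K n`. As `Q` is within `2 αs((K n)ᶜ)` of `αs ∈ C`, the event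
`L_n ∈ C_n` contains `{dbar Q L_n ≤ η n}`. Discretising on a partition subordinate to a covering
of `K n` by balls of radius `η n / 8`, Hoeffding's inequality and a union bound show that this has
probability tending to `1` under `Q` (`measureReal_dbar_empiricalProb_gt_le`); the growth
condition on `η` is what makes the union bound small. The cost of the change of measure is
`n H(Q | α)`, and `H(Q | α)` tends to `H(αs | α) = H`. Hence
`-log P(L_n ∈ C_n) ≤ n (H + o(1))`.

*Upper bound* (`entropy_add_deviation_le`). Let `P_n` be the law of the sample given `L_n ∈ C_n`. It
is exchangeable, with marginal `β_n`. Jensen's inequality under `P_n`, for the density of `β_n^{⊗n}`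
times the exponential of `t` times the number of visits to `B` by disjoint blocks of length `k`,
yields
`n H(β_n | α) + ⌊n/k⌋ t (P_n^{(k)}(B) - β_n^{⊗k}(B)) ≤ -log P(L_n ∈ C_n) + ⌊n/k⌋ t ^ 2`
for `|t| ≤ 1`, where `P_n^{(k)}` is the law of `k` coordinates.

The barycentre `β_n` belongs to `C_n`, because enlargements of convex sets are convex
(`barycenter_mem_enlargement`). Since `C` is closed and convex, entropy on thin enlargements of `C` is
at least `H - o(1)` (`exists_enlargement_entropy_ge`); no compactness is needed, because strict
convexity makes almost minimisers a Cauchy sequence in total variation. With `t = 0` the two estimates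
give `H(β_n | α) ≤ H + o(1)`, so that `β_n` tends to `αs` in total variation
(`exists_enlargement_close_to_projection`). With `t = ± r` they give
`|P_n^{(k)}(B) - β_n^{⊗k}(B)| ≤ r + o(1)`, uniformly in `B`. The two facts together are the claim
(`eventually_condProb_close`).

Either alternative of the theorem entails that `αs(K n)` tends to `1`, the form in which it is used.
-/

noncomputable section

namespace ThinConstraints

/-! ### The Prohorov and Fortet-Mourier metrics -/

section

variable {E : Type*}

/-- The properties of a distance between probability measures on which the argument rests. They are
shared by the Prohorov and the Fortet-Mourier metrics. -/
structure IsAdmissible [MetricSpace E] [MeasurableSpace E] [OpensMeasurableSpace E]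
    (dbar : ProbabilityMeasure E → ProbabilityMeasure E → ℝ) : Prop where
  nonneg : ∀ μ ν, 0 ≤ dbar μ ν
  symm : ∀ μ ν, dbar μ ν = dbar ν μ
  triangle : ∀ μ ν ρ, dbar μ ρ ≤ dbar μ ν + dbar ν ρ
  /-- Joint quasi-convexity: a mixture is no further from a mixture than the components are. -/
  mix : ∀ a b : ℝ≥0, a + b = 1 → ∀ μ ν μ' ν' ρ ρ' : ProbabilityMeasure E,
    (ρ : Measure E) = a • (μ : Measure E) + b • (ν : Measure E) →
    (ρ' : Measure E) = a • (μ' : Measure E) + b • (ν' : Measure E) →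
    ∀ r : ℝ, dbar μ μ' ≤ r → dbar ν ν' ≤ r → dbar ρ ρ' ≤ r
  /-- A coupling that moves points by at most `δ`, outside an event of probability `δ'`. -/
  coupling : ∀ (π : Measure (E × E)) [IsProbabilityMeasure π] (μ ν : ProbabilityMeasure E),
    π.map Prod.fst = (μ : Measure E) → π.map Prod.snd = (ν : Measure E) →
    ∀ δ δ' : ℝ, 0 ≤ δ → π.real {z | δ < dist z.1 z.2} ≤ δ' → dbar μ ν ≤ δ + 2 * δ'
  /-- Domination by the total variation distance. -/
  tv : ∀ (μ ν : ProbabilityMeasure E) (r : ℝ),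
    (∀ B, MeasurableSet B → (μ : Measure E).real B ≤ (ν : Measure E).real B + r) →
    dbar μ ν ≤ 2 * r
  /-- Convergence for the distance implies narrow convergence. -/
  tendsto : ∀ (μ : ℕ → ProbabilityMeasure E) (ν : ProbabilityMeasure E),
    Tendsto (fun m => dbar (μ m) ν) atTop (𝓝 0) → Tendsto μ atTop (𝓝 ν)

section Prohorov

variable [MetricSpace E] [MeasurableSpace E]

lemma measure_le_of_prohorovDist_lt {μ ν : ProbabilityMeasure E} {s : ℝ}
    (h : prohorovDist μ ν < s) {B : Set E} (hB : MeasurableSet B) :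
    (μ : Measure E) B ≤ (ν : Measure E) (Metric.thickening s B) + ENNReal.ofReal s := by
  have h0 : 0 ≤ prohorovDist μ ν := ENNReal.toReal_nonneg
  have hs : 0 < s := h0.trans_lt h
  have h1 : levyProkhorovEDist (μ : Measure E) (ν : Measure E) < ENNReal.ofReal s := by
    rwa [ENNReal.lt_ofReal_iff_toReal_lt (levyProkhorovEDist_ne_top _ _)]
  simpa [ENNReal.toReal_ofReal hs.le] using left_measure_le_of_levyProkhorovEDist_lt h1 hB

lemma isAdmissible_prohorovDist [OpensMeasurableSpace E] [SecondCountableTopology E]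
    [BorelSpace E] :
    IsAdmissible (prohorovDist : ProbabilityMeasure E → ProbabilityMeasure E → ℝ) where
  nonneg μ ν := ENNReal.toReal_nonneg
  symm μ ν := levyProkhorovDist_comm _ _
  triangle μ ν ρ := levyProkhorovDist_triangle _ _ _
  mix a b hab μ ν μ' ν' ρ ρ' hρ hρ' r h1 h2 := by
    have hr : 0 ≤ r := le_trans ENNReal.toReal_nonneg h1
    refine levyProkhorovDist_le_of_forall_le _ _ hr fun s B hs hB => ?_
    have e1 := measure_le_of_prohorovDist_lt (h1.trans_lt hs) hB
    have e2 := measure_le_of_prohorovDist_lt (h2.trans_lt hs) hB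
    have hab' : (a : ℝ≥0∞) + b = 1 := by exact_mod_cast hab
    rw [hρ, hρ']
    simp only [Measure.add_apply, Measure.smul_apply, ENNReal.smul_def, smul_eq_mul]
    calc (a : ℝ≥0∞) * (μ : Measure E) B + b * (ν : Measure E) B
        ≤ a * ((μ' : Measure E) (Metric.thickening s B) + ENNReal.ofReal s)
          + b * ((ν' : Measure E) (Metric.thickening s B) + ENNReal.ofReal s) := by gcongr
      _ = a * (μ' : Measure E) (Metric.thickening s B)
          + b * (ν' : Measure E) (Metric.thickening s B) + (a + b) * ENNReal.ofReal s := by ring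
      _ = _ := by rw [hab', one_mul]
  coupling π _ μ ν hμ hν δ δ' hδ h := by
    have h0 : 0 ≤ δ' := measureReal_nonneg.trans h
    refine levyProkhorovDist_le_of_forall_le _ _ (by positivity) fun s B hs hB => ?_
    rw [← hμ, ← hν, Measure.map_apply measurable_fst hB,
      Measure.map_apply measurable_snd Metric.isOpen_thickening.measurableSet]
    have hsub : Prod.fst ⁻¹' B ⊆
        Prod.snd ⁻¹' (Metric.thickening s B) ∪ {z : E × E | δ < dist z.1 z.2} := by
      intro z hz
      by_cases hd : δ < dist z.1 z.2
      · exact Or.inr hd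
      · left
        simp only [Set.mem_preimage, Metric.mem_thickening_iff]
        exact ⟨z.1, hz, by rw [dist_comm]; linarith⟩
    refine (measure_mono hsub).trans ((measure_union_le _ _).trans ?_)
    gcongr
    rw [← ofReal_measureReal]
    exact ENNReal.ofReal_le_ofReal (by linarith)
  tv μ ν r h := by
    have hr : 0 ≤ r := by simpa using h ∅ MeasurableSet.empty
    refine levyProkhorovDist_le_of_forall_le _ _ (by positivity) fun s B hs hB => ?_
    have hs0 : 0 < s := by linarith
    calc (μ : Measure E) B = ENNReal.ofReal ((μ : Measure E).real B) := by
          rw [ofReal_measureReal]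
      _ ≤ ENNReal.ofReal ((ν : Measure E).real B + s) := by
          apply ENNReal.ofReal_le_ofReal
          have := h B hB
          linarith
      _ = (ν : Measure E) B + ENNReal.ofReal s := by
          rw [ENNReal.ofReal_add measureReal_nonneg hs0.le, ofReal_measureReal]
      _ ≤ _ := by
          gcongr
          exact Metric.self_subset_thickening hs0 B
  tendsto μ ν h := by
    have h1 : Tendsto (fun m => LevyProkhorov.ofMeasure (μ m)) atTop
        (𝓝 (LevyProkhorov.ofMeasure ν)) := by
      rw [tendsto_iff_dist_tendsto_zero]
      exact h
    exact (LevyProkhorov.continuous_toMeasure_probabilityMeasure.tendsto _).comp h1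

end Prohorov

/-- A one-sided bound for the difference on sets controls the integrals of functions with values in
`[-1, 1]`. -/
lemma integral_sub_le_of_measureReal_le [MeasurableSpace E] {μ ν : Measure E} [IsProbabilityMeasure μ]
    [IsProbabilityMeasure ν] {r : ℝ} (h : ∀ B, MeasurableSet B → μ.real B ≤ ν.real B + r)
    {f : E → ℝ} (hf : Measurable f) (hf1 : ∀ x, |f x| ≤ 1) :
    ∫ x, f x ∂μ - ∫ x, f x ∂ν ≤ 2 * r := by
  have hint (ρ : Measure E) [IsProbabilityMeasure ρ] : Integrable f ρ :=
    Integrable.of_bound hf.aestronglyMeasurable 1 (ae_of_all _ hf1)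
  -- The layer-cake formula for the function `f + 1`, which has values in `[0, 2]`.
  have key (ρ : Measure E) [IsProbabilityMeasure ρ] :
      ∫ x, f x ∂ρ + 1 = ∫ t in Set.Ioc (0 : ℝ) 2, ρ.real {a | t ≤ f a + 1} := by
    have hg := Integrable.integral_eq_integral_Ioc_meas_le (f := fun x => f x + 1) (M := 2)
      ((hint ρ).add (integrable_const 1))
      (ae_of_all _ fun x => by have := abs_le.1 (hf1 x); simp; linarith)
      (ae_of_all _ fun x => by have := abs_le.1 (hf1 x); dsimp only; linarith)
    rw [← hg, integral_add (hint ρ) (integrable_const 1)]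
    simp
  have hi (ρ : Measure E) [IsProbabilityMeasure ρ] :
      IntegrableOn (fun t : ℝ => ρ.real {a | t ≤ f a + 1}) (Set.Ioc (0 : ℝ) 2) := by
    have ha : Antitone (fun t : ℝ => ρ.real {a | t ≤ f a + 1}) := fun s t hst =>
      measureReal_mono (fun a (ha : t ≤ f a + 1) => hst.trans ha)
    exact Integrable.of_bound ha.measurable.aestronglyMeasurable 1
      (ae_of_all _ fun t => by
        rw [Real.norm_of_nonneg measureReal_nonneg]; exact measureReal_le_one)
  have hle : ∫ t in Set.Ioc (0 : ℝ) 2, μ.real {a | t ≤ f a + 1}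
      ≤ ∫ t in Set.Ioc (0 : ℝ) 2, (ν.real {a | t ≤ f a + 1} + r) :=
    integral_mono (hi μ) ((hi ν).add (integrable_const r)) fun t =>
      h _ (measurableSet_le measurable_const (hf.add measurable_const))
  rw [integral_add (hi ν) (integrable_const r), ← key, ← key] at hle
  simp at hle
  linarith

section FortetMourier

variable [MetricSpace E]

lemma bLipUnitBall.abs_le_one {f : E → ℝ} (hf : f ∈ bLipUnitBall E) (x : E) : |f x| ≤ 1 := by
  obtain ⟨a, b, hab, h1, -⟩ := hf
  have hab' : (a : ℝ) + b ≤ 1 := by exact_mod_cast hab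
  linarith [h1 x, b.coe_nonneg]

lemma bLipUnitBall.lipschitz {f : E → ℝ} (hf : f ∈ bLipUnitBall E) : LipschitzWith 1 f := by
  obtain ⟨a, b, hab, -, h1⟩ := hf
  exact h1.weaken (le_trans le_add_self hab)

lemma zero_mem_bLipUnitBall : (fun _ => 0 : E → ℝ) ∈ bLipUnitBall E :=
  ⟨0, 0, by simp, by simp, LipschitzWith.const 0⟩

instance : Nonempty (bLipUnitBall E) := ⟨⟨_, zero_mem_bLipUnitBall⟩⟩

lemma bLipUnitBall.neg {f : E → ℝ} (hf : f ∈ bLipUnitBall E) : (fun x => -f x) ∈ bLipUnitBall E := by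
  obtain ⟨a, b, hab, h1, h2⟩ := hf
  exact ⟨a, b, hab, by simpa using h1, h2.neg⟩

variable [MeasurableSpace E]

lemma bddAbove_fortetMourier (μ ν : ProbabilityMeasure E) :
    BddAbove (Set.range fun f : bLipUnitBall E =>
      (∫ x, f.1 x ∂(μ : Measure E) - ∫ x, f.1 x ∂(ν : Measure E))) := by
  refine ⟨2, ?_⟩
  rintro _ ⟨f, rfl⟩
  have h (ρ : ProbabilityMeasure E) : |∫ x, f.1 x ∂(ρ : Measure E)| ≤ 1 := by
    simpa using norm_integral_le_of_norm_le_const (f := f.1) (μ := (ρ : Measure E)) (C := 1)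
      (ae_of_all _ (bLipUnitBall.abs_le_one f.2))
  have h1 := abs_le.1 (h μ)
  have h2 := abs_le.1 (h ν)
  dsimp only
  linarith

lemma fortetMourierDist_le {μ ν : ProbabilityMeasure E} {r : ℝ}
    (h : ∀ f ∈ bLipUnitBall E, ∫ x, f x ∂(μ : Measure E) - ∫ x, f x ∂(ν : Measure E) ≤ r) :
    fortetMourierDist μ ν ≤ r :=
  ciSup_le fun f => h f.1 f.2

lemma integral_sub_le_fortetMourierDist (μ ν : ProbabilityMeasure E) {f : E → ℝ}
    (hf : f ∈ bLipUnitBall E) :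
    ∫ x, f x ∂(μ : Measure E) - ∫ x, f x ∂(ν : Measure E) ≤ fortetMourierDist μ ν :=
  le_ciSup (bddAbove_fortetMourier μ ν) (⟨f, hf⟩ : bLipUnitBall E)

lemma fortetMourierDist_comm (μ ν : ProbabilityMeasure E) :
    fortetMourierDist μ ν = fortetMourierDist ν μ := by
  have h (μ ν : ProbabilityMeasure E) : fortetMourierDist μ ν ≤ fortetMourierDist ν μ := by
    refine fortetMourierDist_le fun f hf => ?_
    have := integral_sub_le_fortetMourierDist ν μ (bLipUnitBall.neg hf)
    rw [integral_neg, integral_neg] at this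
    linarith
  exact le_antisymm (h μ ν) (h ν μ)

variable [OpensMeasurableSpace E]

lemma bLipUnitBall.integrable {f : E → ℝ} (hf : f ∈ bLipUnitBall E) (μ : Measure E)
    [IsFiniteMeasure μ] : Integrable f μ :=
  Integrable.of_bound (bLipUnitBall.lipschitz hf).continuous.measurable.aestronglyMeasurable 1
    (ae_of_all _ (bLipUnitBall.abs_le_one hf))

lemma isAdmissible_fortetMourierDist [SecondCountableTopology E] [BorelSpace E] :
    IsAdmissible (fortetMourierDist : ProbabilityMeasure E → ProbabilityMeasure E → ℝ) where
  nonneg μ ν := by simpa using integral_sub_le_fortetMourierDist μ ν zero_mem_bLipUnitBall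
  symm := fortetMourierDist_comm
  triangle μ ν ρ := fortetMourierDist_le fun f hf => by
    linarith [integral_sub_le_fortetMourierDist μ ν hf, integral_sub_le_fortetMourierDist ν ρ hf]
  mix a b hab μ ν μ' ν' ρ ρ' hρ hρ' r h1 h2 := fortetMourierDist_le fun f hf => by
    have hab' : (a : ℝ) + b = 1 := by exact_mod_cast hab
    have e1 := (integral_sub_le_fortetMourierDist μ μ' hf).trans h1
    have e2 := (integral_sub_le_fortetMourierDist ν ν' hf).trans h2
    have hint (κ : ProbabilityMeasure E) (c : ℝ≥0) : Integrable f (c • (κ : Measure E)) :=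
      bLipUnitBall.integrable hf _
    rw [hρ, hρ', integral_add_measure (hint _ _) (hint _ _),
      integral_add_measure (hint _ _) (hint _ _)]
    simp only [integral_smul_nnreal_measure, NNReal.smul_def, smul_eq_mul]
    calc _ = (a : ℝ) * (∫ x, f x ∂(μ : Measure E) - ∫ x, f x ∂(μ' : Measure E))
          + b * (∫ x, f x ∂(ν : Measure E) - ∫ x, f x ∂(ν' : Measure E)) := by ring
      _ ≤ a * r + b * r := by gcongr
      _ = r := by rw [← add_mul, hab', one_mul]
  coupling π _ μ ν hμ hν δ δ' hδ h := fortetMourierDist_le fun f hf => by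
    have hm := (bLipUnitBall.lipschitz hf).continuous.measurable
    have hS : MeasurableSet {z : E × E | δ < dist z.1 z.2} :=
      measurableSet_lt measurable_const (measurable_fst.dist measurable_snd)
    have hi1 : Integrable (fun z : E × E => f z.1) π :=
      Integrable.of_bound (hm.comp measurable_fst).aestronglyMeasurable 1
        (ae_of_all _ fun z => bLipUnitBall.abs_le_one hf _)
    have hi2 : Integrable (fun z : E × E => f z.2) π :=
      Integrable.of_bound (hm.comp measurable_snd).aestronglyMeasurable 1
        (ae_of_all _ fun z => bLipUnitBall.abs_le_one hf _)
    rw [← hμ, ← hν, integral_map measurable_fst.aemeasurable hm.aestronglyMeasurable,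
      integral_map measurable_snd.aemeasurable hm.aestronglyMeasurable, ← integral_sub hi1 hi2]
    have hi3 : Integrable ({z : E × E | δ < dist z.1 z.2}.indicator fun _ => (2 : ℝ)) π :=
      (integrable_const _).indicator hS
    calc _ ≤ ∫ z, (δ + {z : E × E | δ < dist z.1 z.2}.indicator (fun _ => (2 : ℝ)) z) ∂π := by
          refine integral_mono (hi1.sub hi2) ((integrable_const δ).add hi3) fun z => ?_
          dsimp only
          by_cases hz : δ < dist z.1 z.2
          · rw [Set.indicator_of_mem (by exact hz)]
            have h1 := abs_le.1 (bLipUnitBall.abs_le_one hf z.1)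
            have h2 := abs_le.1 (bLipUnitBall.abs_le_one hf z.2)
            linarith
          · rw [Set.indicator_of_notMem (by exact hz)]
            have h1 := (bLipUnitBall.lipschitz hf).dist_le_mul z.1 z.2
            rw [Real.dist_eq] at h1
            have h2 := (le_abs_self _).trans h1
            simp at h2
            linarith
      _ = δ + 2 * π.real {z : E × E | δ < dist z.1 z.2} := by
          rw [integral_add (integrable_const δ) hi3, integral_indicator_const _ hS]
          simp [mul_comm]
      _ ≤ _ := by gcongr
  tv μ ν r h := fortetMourierDist_le fun f hf =>
    integral_sub_le_of_measureReal_le h (bLipUnitBall.lipschitz hf).continuous.measurable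
      (bLipUnitBall.abs_le_one hf)
  tendsto μ ν h := by
    rw [tendsto_iff_forall_lipschitz_integral_tendsto]
    rintro f ⟨M, hM⟩ ⟨L, hL⟩
    rcases isEmpty_or_nonempty E with hE | ⟨⟨x0⟩⟩
    · simp [Subsingleton.elim f 0]
    have hM0 : 0 ≤ M := dist_nonneg.trans (hM x0 x0)
    -- A positive multiple of `f` lies in the unit ball.
    obtain ⟨M', hM'⟩ : ∃ M' : ℝ≥0, (M' : ℝ) = |f x0| + M := ⟨⟨|f x0| + M, by positivity⟩, rfl⟩
    set c : ℝ≥0 := M' + L + 1 with hc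
    have hc0 : c ≠ 0 := by positivity
    have hball : (fun x => (c : ℝ)⁻¹ * f x) ∈ bLipUnitBall E := by
      refine ⟨c⁻¹ * M', c⁻¹ * L, ?_, fun x => ?_, ?_⟩
      · rw [← mul_add, inv_mul_le_iff₀ (by positivity), mul_one, hc]
        exact le_self_add
      · rw [abs_mul, abs_of_nonneg (by positivity : (0 : ℝ) ≤ (c : ℝ)⁻¹)]
        push_cast
        gcongr
        rw [hM']
        have h1 := hM x x0
        rw [Real.dist_eq] at h1
        have h2 := abs_sub_abs_le_abs_sub (f x) (f x0)
        linarith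
      · refine LipschitzWith.of_dist_le_mul fun x y => ?_
        rw [Real.dist_eq, ← mul_sub, abs_mul, abs_of_nonneg (by positivity : (0 : ℝ) ≤ (c : ℝ)⁻¹)]
        push_cast
        rw [mul_assoc]
        gcongr
        have := hL.dist_le_mul x y
        rwa [Real.dist_eq] at this
    have hcpos : (0 : ℝ) < c := by positivity
    have hbound (m : ℕ) : |∫ x, f x ∂(μ m : Measure E) - ∫ x, f x ∂(ν : Measure E)|
        ≤ c * fortetMourierDist (μ m) ν := by
      have h1 := integral_sub_le_fortetMourierDist (μ m) ν hball
      have h2 := integral_sub_le_fortetMourierDist ν (μ m) hball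
      rw [fortetMourierDist_comm] at h2
      simp only [integral_const_mul, ← mul_sub] at h1 h2
      rw [inv_mul_le_iff₀ hcpos] at h1 h2
      rw [abs_le]
      constructor <;> linarith
    rw [tendsto_iff_dist_tendsto_zero]
    refine squeeze_zero (fun _ => dist_nonneg) (fun m => hbound m) ?_
    simpa using h.const_mul (c : ℝ)

end FortetMourier

end

/-! ### Enlargements of convex sets and barycentres -/

section

variable {E : Type*}

lemma enlargement_mono [MeasurableSpace E]
    {dbar : ProbabilityMeasure E → ProbabilityMeasure E → ℝ} {C : Set (ProbabilityMeasure E)}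
    {ε ε' : ℝ} (h : ε ≤ ε') :
    enlargement dbar C ε ⊆ enlargement dbar C ε' := fun _ hν => le_trans hν h

lemma exists_mixture [MeasurableSpace E] (μ ν : ProbabilityMeasure E) {a b : ℝ≥0} (hab : a + b = 1) :
    ∃ ρ : ProbabilityMeasure E, (ρ : Measure E) = a • (μ : Measure E) + b • (ν : Measure E) :=
  ⟨⟨a • (μ : Measure E) + b • (ν : Measure E), ⟨by
    simp only [Measure.add_apply, Measure.smul_apply, ENNReal.smul_def, smul_eq_mul, measure_univ,
      mul_one]
    exact_mod_cast hab⟩⟩, rfl⟩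

section Enlargement

variable [MetricSpace E] [MeasurableSpace E] [OpensMeasurableSpace E]
  {dbar : ProbabilityMeasure E → ProbabilityMeasure E → ℝ} {C : Set (ProbabilityMeasure E)}

lemma IsAdmissible.bddBelow (hd : IsAdmissible dbar) (C : Set (ProbabilityMeasure E))
    (ν : ProbabilityMeasure E) : BddBelow (Set.range fun μ : C => dbar μ ν) :=
  ⟨0, by rintro _ ⟨μ, rfl⟩; exact hd.nonneg _ _⟩

lemma mem_enlargement_iff (hd : IsAdmissible dbar) (hC : C.Nonempty) {ε : ℝ}
    {ν : ProbabilityMeasure E} :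
    ν ∈ enlargement dbar C ε ↔ ∀ δ > 0, ∃ μ ∈ C, dbar μ ν < ε + δ := by
  have : Nonempty C := hC.to_subtype
  constructor
  · intro h δ hδ
    obtain ⟨μ, hμ⟩ := exists_lt_of_ciInf_lt
      (show (⨅ μ : C, dbar μ ν) < ε + δ from lt_of_le_of_lt h (lt_add_of_pos_right ε hδ))
    exact ⟨μ, μ.2, hμ⟩
  · intro h
    change (⨅ μ : C, dbar μ ν) ≤ ε
    refine le_of_forall_pos_le_add fun δ hδ => ?_
    obtain ⟨μ, hμ, h1⟩ := h δ hδ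
    exact (ciInf_le (hd.bddBelow C ν) ⟨μ, hμ⟩).trans h1.le

lemma mem_enlargement_of_le (hd : IsAdmissible dbar) {μ ν : ProbabilityMeasure E} (hμ : μ ∈ C)
    {ε : ℝ} (h : dbar μ ν ≤ ε) : ν ∈ enlargement dbar C ε :=
  (ciInf_le (hd.bddBelow C ν) ⟨μ, hμ⟩).trans h

lemma isConvexSet_enlargement (hd : IsAdmissible dbar) (hC : C.Nonempty) (hconv : IsConvexSet C)
    (ε : ℝ) : IsConvexSet (enlargement dbar C ε) := by
  intro μ hμ ν hν a b hab ρ hρ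
  rw [mem_enlargement_iff hd hC] at hμ hν ⊢
  intro δ hδ
  obtain ⟨μ', hμ', h1⟩ := hμ (δ / 2) (half_pos hδ)
  obtain ⟨ν', hν', h2⟩ := hν (δ / 2) (half_pos hδ)
  obtain ⟨ρ', hρ'⟩ := exists_mixture μ' ν' hab
  refine ⟨ρ', hconv μ' hμ' ν' hν' a b hab ρ' hρ', ?_⟩
  have := hd.mix a b hab μ' ν' μ ν ρ' ρ hρ' hρ _ h1.le h2.le
  linarith

end Enlargement

section FiniteMixtures

variable [MeasurableSpace E]

/-- A convex set of probability measures is stable under finite mixtures. The claim is Jensen's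
`Convex.sum_mem` for the set functions `B ↦ ν(B)`, which live in a vector space. -/
lemma IsConvexSet.sum_mem {D : Set (ProbabilityMeasure E)} (hD : IsConvexSet D) {ι : Type*}
    (s : Finset ι) (w : ι → ℝ) (ν : ι → ProbabilityMeasure E) (hw : ∀ i ∈ s, 0 ≤ w i)
    (hw1 : ∑ i ∈ s, w i = 1) (hν : ∀ i ∈ s, ν i ∈ D) (ρ : ProbabilityMeasure E)
    (hρ : ∀ B, MeasurableSet B →
      (ρ : Measure E).real B = ∑ i ∈ s, w i * (ν i : Measure E).real B) : ρ ∈ D := by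
  let V : Set ({B : Set E // MeasurableSet B} → ℝ) :=
    {g | ∃ κ ∈ D, ∀ B, g B = (κ : Measure E).real B.1}
  have hV : Convex ℝ V := by
    rintro g ⟨κ, hκ, hg⟩ g' ⟨κ', hκ', hg'⟩ a b ha hb hab
    lift a to ℝ≥0 using ha
    lift b to ℝ≥0 using hb
    have hab' : a + b = 1 := by exact_mod_cast hab
    have hmass : IsProbabilityMeasure (a • (κ : Measure E) + b • (κ' : Measure E)) := ⟨by
      simp only [Measure.add_apply, Measure.smul_apply, ENNReal.smul_def, smul_eq_mul,
        measure_univ, mul_one]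
      exact_mod_cast hab'⟩
    refine ⟨⟨_, hmass⟩, hD κ hκ κ' hκ' a b hab' _ rfl, fun B => ?_⟩
    change a * g B + b * g' B = (a • (κ : Measure E) + b • (κ' : Measure E)).real B.1
    rw [measureReal_add_apply, measureReal_nnreal_smul_apply, measureReal_nnreal_smul_apply,
      hg, hg']
  have hmem : (∑ i ∈ s, w i • fun B : {B : Set E // MeasurableSet B} =>
      (ν i : Measure E).real B.1) ∈ V :=
    hV.sum_mem hw hw1 fun i hi => ⟨ν i, hν i hi, fun B => rfl⟩
  obtain ⟨κ, hκ, h⟩ := hmem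
  have : ρ = κ := by
    apply ProbabilityMeasure.toMeasure_injective
    ext B hB
    rw [← ofReal_measureReal, ← ofReal_measureReal, ← h ⟨B, hB⟩, hρ B hB]
    simp [Finset.sum_apply]
  rwa [this]

end FiniteMixtures

section Average

variable {Z : Type*} [MeasurableSpace Z] [MeasurableSpace E]

/-- The average of the laws of the variables `Y 0, …, Y (n - 1)` under `P`. -/
def averageLaw {n : ℕ} (P : Measure Z) (Y : Fin n → Z → E) : Measure E :=
  (n : ℝ≥0∞)⁻¹ • ∑ i, P.map (Y i)

lemma averageLaw_apply {n : ℕ} (P : Measure Z) {Y : Fin n → Z → E} (hY : ∀ i, Measurable (Y i))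
    {B : Set E} (hB : MeasurableSet B) :
    averageLaw P Y B = (n : ℝ≥0∞)⁻¹ * ∑ i, P (Y i ⁻¹' B) := by
  simp only [averageLaw, Measure.smul_apply, Measure.finsetSum_apply, smul_eq_mul]
  congr 1
  exact Finset.sum_congr rfl fun i _ => Measure.map_apply (hY i) hB

lemma isProbabilityMeasure_averageLaw {n : ℕ} [NeZero n] (P : Measure Z) [IsProbabilityMeasure P]
    {Y : Fin n → Z → E} (hY : ∀ i, Measurable (Y i)) : IsProbabilityMeasure (averageLaw P Y) :=
  ⟨by
    rw [averageLaw_apply P hY MeasurableSet.univ]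
    simp [ENNReal.inv_mul_cancel (Nat.cast_ne_zero.2 (NeZero.ne n)) (ENNReal.natCast_ne_top n)]⟩

lemma averageLaw_map {F : Type*} [MeasurableSpace F] {n : ℕ} (P : Measure Z) {Y : Fin n → Z → E}
    (hY : ∀ i, Measurable (Y i)) {g : E → F} (hg : Measurable g) :
    (averageLaw P Y).map g = averageLaw P (fun i z => g (Y i z)) := by
  ext B hB
  rw [Measure.map_apply hg hB, averageLaw_apply P hY (hg hB),
    averageLaw_apply (Y := fun i z => g (Y i z)) P (fun i => hg.comp (hY i)) hB]
  rfl

/-- Variables that are close with large probability have close average laws: the average of the joint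
laws is a coupling. -/
lemma IsAdmissible.averageLaw_le [MetricSpace E] [SecondCountableTopology E] [BorelSpace E]
    {dbar : ProbabilityMeasure E → ProbabilityMeasure E → ℝ} (hd : IsAdmissible dbar)
    {n : ℕ} [NeZero n] (P : Measure Z) [IsProbabilityMeasure P] {Y Y' : Fin n → Z → E}
    (hY : ∀ i, Measurable (Y i)) (hY' : ∀ i, Measurable (Y' i)) {μ ν : ProbabilityMeasure E}
    (hμ : (μ : Measure E) = averageLaw P Y) (hν : (ν : Measure E) = averageLaw P Y')
    {δ δ' : ℝ} (hδ : 0 ≤ δ) (h : ∀ i, P.real {z | δ < dist (Y i z) (Y' i z)} ≤ δ') :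
    dbar μ ν ≤ δ + 2 * δ' := by
  have hYY : ∀ i, Measurable (fun z => (Y i z, Y' i z)) := fun i => (hY i).prodMk (hY' i)
  have := isProbabilityMeasure_averageLaw P hYY
  refine hd.coupling (averageLaw P fun i z => (Y i z, Y' i z)) μ ν ?_ ?_ δ δ' hδ ?_
  · rw [averageLaw_map P hYY measurable_fst, hμ]
  · rw [averageLaw_map P hYY measurable_snd, hν]
  · have hS : MeasurableSet {z : E × E | δ < dist z.1 z.2} :=
      measurableSet_lt measurable_const (measurable_fst.dist measurable_snd)
    have hn : (0 : ℝ) < n := Nat.cast_pos.2 (NeZero.pos n)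
    rw [measureReal_def, averageLaw_apply P hYY hS, ENNReal.toReal_mul,
      ENNReal.toReal_sum (fun i _ => measure_ne_top _ _), ENNReal.toReal_inv, ENNReal.toReal_natCast,
      inv_mul_le_iff₀ hn]
    calc _ ≤ ∑ _i : Fin n, δ' := Finset.sum_le_sum fun i _ => h i
      _ = n * δ' := by simp

end Average

section Empirical

variable [MeasurableSpace E]

/-- The empirical measure of a nonempty sample, as a probability measure. -/
def empiricalProb {n : ℕ} [NeZero n] (x : Fin n → E) : ProbabilityMeasure E :=
  ⟨averageLaw (Measure.dirac ()) (fun i _ => x i),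
    isProbabilityMeasure_averageLaw _ fun _ => measurable_const⟩

lemma coe_empiricalProb {n : ℕ} [NeZero n] (x : Fin n → E) :
    (empiricalProb x : Measure E) = averageLaw (Measure.dirac ()) (fun i _ => x i) := rfl

lemma coe_empiricalProb_eq_empiricalMeasure {n : ℕ} [NeZero n] (x : ℕ → E) :
    (empiricalProb (fun i : Fin n => x i) : Measure E) = empiricalMeasure n x := by
  rw [coe_empiricalProb, averageLaw, empiricalMeasure, Finset.sum_range]
  simp

lemma empiricalProb_apply {n : ℕ} [NeZero n] (x : Fin n → E) {B : Set E} (hB : MeasurableSet B) :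
    (empiricalProb x : Measure E) B = (n : ℝ≥0∞)⁻¹ * ∑ i, B.indicator 1 (x i) := by
  rw [coe_empiricalProb, averageLaw_apply _ (fun _ => measurable_const) hB]
  congr 1
  refine Finset.sum_congr rfl fun i _ => ?_
  by_cases h : x i ∈ B <;> simp [h]

lemma empiricalProb_real_apply {n : ℕ} [NeZero n] (x : Fin n → E) {B : Set E}
    (hB : MeasurableSet B) :
    (empiricalProb x : Measure E).real B = (n : ℝ)⁻¹ * ∑ i, B.indicator 1 (x i) := by
  rw [measureReal_def, empiricalProb_apply x hB, ENNReal.toReal_mul, ENNReal.toReal_inv,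
    ENNReal.toReal_natCast, ENNReal.toReal_sum]
  · congr 1
    refine Finset.sum_congr rfl fun i _ => ?_
    by_cases h : x i ∈ B <;> simp [h]
  · intro i _
    by_cases h : x i ∈ B <;> simp [h]

lemma empiricalProb_comp_perm {n : ℕ} [NeZero n] (x : Fin n → E) (σ : Equiv.Perm (Fin n)) :
    empiricalProb (fun i => x (σ i)) = empiricalProb x := by
  apply ProbabilityMeasure.toMeasure_injective
  ext B hB
  rw [empiricalProb_apply _ hB, empiricalProb_apply _ hB]
  congr 1
  exact Equiv.sum_comp σ fun i => B.indicator 1 (x i)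

variable [MetricSpace E] [SecondCountableTopology E] [BorelSpace E]
  {dbar : ProbabilityMeasure E → ProbabilityMeasure E → ℝ} {C : Set (ProbabilityMeasure E)}

/-- The set of samples whose empirical measure lies in an enlargement is closed, because the map
`x ↦ inf_{μ ∈ C} dbar μ (L_x)` is `1`-Lipschitz for the sup distance. -/
lemma isClosed_empiricalProb_mem (hd : IsAdmissible dbar) (hC : C.Nonempty) (n : ℕ) [NeZero n]
    (ε : ℝ) : IsClosed {x : Fin n → E | empiricalProb x ∈ enlargement dbar C ε} := by
  have : Nonempty C := hC.to_subtype
  have hdist (x y : Fin n → E) : dbar (empiricalProb x) (empiricalProb y) ≤ dist x y := by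
    have := hd.averageLaw_le (Measure.dirac ()) (fun _ => measurable_const)
      (fun _ => measurable_const) (coe_empiricalProb x) (coe_empiricalProb y) (δ := dist x y)
      (δ' := 0) dist_nonneg fun i => by
        have h : ¬ dist x y < dist (x i) (y i) := not_lt.2 (dist_le_pi_dist x y i)
        simp [h]
    simpa using this
  have hlip : LipschitzWith 1
      (fun x : Fin n → E => ⨅ μ : C, dbar μ (empiricalProb x)) := by
    refine LipschitzWith.of_le_add fun x y => ?_
    rw [ciInf_add (hd.bddBelow C _)]
    refine ciInf_mono (hd.bddBelow C _) fun μ => ?_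
    have := hd.triangle μ (empiricalProb y) (empiricalProb x)
    have h2 := hdist y x
    rw [dist_comm] at h2
    linarith
  exact isClosed_le hlip.continuous continuous_const

/-- An enlargement of a convex set contains the barycentre of every law on samples under which the
empirical measure almost surely belongs to it. -/
lemma barycenter_mem_enlargement (hd : IsAdmissible dbar) (hC : C.Nonempty)
    (hconv : IsConvexSet C) {n : ℕ} [NeZero n] (P : Measure (Fin n → E)) [IsProbabilityMeasure P]
    {ε : ℝ} (hP : ∀ᵐ x ∂P, empiricalProb x ∈ enlargement dbar C ε)
    {β : ProbabilityMeasure E} (hβ : (β : Measure E) = averageLaw P (fun i x => x i)) :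
    β ∈ enlargement dbar C ε := by
  set A : Set (Fin n → E) := {x | empiricalProb x ∈ enlargement dbar C ε} with hA
  obtain ⟨y0, hy0⟩ : A.Nonempty := by
    obtain ⟨x, hx⟩ := hP.exists
    exact ⟨x, hx⟩
  have hcoord : ∀ i : Fin n, Measurable fun x : Fin n → E => x i := measurable_pi_apply
  rw [mem_enlargement_iff hd hC]
  intro δ hδ
  -- Approximation of the identity by finitely valued maps with values in `A`.
  let f : ℕ → SimpleFunc (Fin n → E) (Fin n → E) :=
    fun m => SimpleFunc.approxOn id measurable_id A y0 hy0 m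
  have hfA (m : ℕ) (x) : f m x ∈ A := SimpleFunc.approxOn_mem _ _ _ _
  have hlim : ∀ᵐ x ∂P, Tendsto (fun m => f m x) atTop (𝓝 x) := by
    filter_upwards [hP] with x hx
    exact SimpleFunc.tendsto_approxOn measurable_id hy0 (subset_closure (s := A) hx)
  have hmeas := tendstoInMeasure_of_tendsto_ae
    (fun m => (f m).aestronglyMeasurable (μ := P)) hlim
  rw [tendstoInMeasure_iff_measureReal_dist] at hmeas
  obtain ⟨m, hm⟩ := ((hmeas (δ / 8) (by positivity)).eventually_le_const
    (show (0 : ℝ) < δ / 8 by positivity)).exists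
  have hfm : ∀ i, Measurable fun x => f m x i := fun i => (hcoord i).comp (f m).measurable
  let βm : ProbabilityMeasure E :=
    ⟨averageLaw P (fun i x => f m x i), isProbabilityMeasure_averageLaw P hfm⟩
  have hβm : βm ∈ enlargement dbar C ε := by
    refine (isConvexSet_enlargement hd hC hconv ε).sum_mem (f m).range
      (fun y => P.real (f m ⁻¹' {y})) (fun y => empiricalProb y) (fun _ _ => measureReal_nonneg)
      ?_ ?_ βm ?_
    · have := (f m).sum_range_measure_preimage_singleton P
      simp only [measure_univ] at this
      simp only [measureReal_def]
      rw [← ENNReal.toReal_sum fun i _ => measure_ne_top _ _, this, ENNReal.toReal_one]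
    · intro y hy
      obtain ⟨x, rfl⟩ := SimpleFunc.mem_range.1 hy
      exact hfA m x
    · intro B hB
      have key (i : Fin n) : P ((fun x => f m x i) ⁻¹' B)
          = ∑ y ∈ (f m).range, B.indicator 1 (y i) * P (f m ⁻¹' {y}) := by
        rw [← SimpleFunc.map_lintegral (fun y => B.indicator 1 (y i)) (f m),
          ← SimpleFunc.lintegral_eq_lintegral, ← lintegral_indicator_one (hfm i hB)]
        rfl
      have hE : (βm : Measure E) B
          = ∑ y ∈ (f m).range, P (f m ⁻¹' {y}) * (empiricalProb y : Measure E) B := by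
        change averageLaw P (fun i x => f m x i) B = _
        rw [averageLaw_apply P hfm hB]
        simp_rw [key, empiricalProb_apply _ hB, Finset.mul_sum]
        rw [Finset.sum_comm]
        exact Finset.sum_congr rfl fun y _ => Finset.sum_congr rfl fun i _ => by ring
      rw [measureReal_def, hE, ENNReal.toReal_sum fun y _ => by finiteness]
      exact Finset.sum_congr rfl fun y _ => by rw [ENNReal.toReal_mul]; rfl
  rw [mem_enlargement_iff hd hC] at hβm
  obtain ⟨μ, hμ, h1⟩ := hβm (δ / 2) (by positivity)
  have h2 : dbar βm β ≤ δ / 8 + 2 * (δ / 8) := by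
    refine hd.averageLaw_le P hfm hcoord rfl hβ (by positivity) fun i => le_trans ?_ hm
    refine measureReal_mono fun x (hx : δ / 8 < _) => ?_
    exact hx.le.trans (dist_le_pi_dist (f m x) x i)
  have h3 := hd.triangle μ βm β
  exact ⟨μ, hμ, by linarith⟩

end Empirical

end

/-! ### Deviations of empirical measures on a compact set -/

section

variable {E : Type*}

/-- Hoeffding's inequality for the empirical frequency of a set. -/
lemma measureReal_empiricalProb_ge_le [MeasurableSpace E] (Q : Measure E) [IsProbabilityMeasure Q]
    {n : ℕ} [NeZero n] {S : Set E} (hS : MeasurableSet S) {r : ℝ} (hr : 0 ≤ r) :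
    (Measure.pi fun _ : Fin n => Q).real
      {x | Q.real S + r ≤ (empiricalProb x : Measure E).real S} ≤ Real.exp (-(2 * n * r ^ 2)) := by
  set μ := Measure.pi fun _ : Fin n => Q with hμ
  have hn : (0 : ℝ) < n := Nat.cast_pos.2 (NeZero.pos n)
  have hm : Measurable (S.indicator (1 : E → ℝ)) := measurable_one.indicator hS
  have hindep : iIndepFun (fun (i : Fin n) (x : Fin n → E) => S.indicator (1 : E → ℝ) (x i) - Q.real S)
      μ :=
    iIndepFun_pi (μ := fun _ : Fin n => Q) (X := fun _ e => S.indicator (1 : E → ℝ) e - Q.real S)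
      fun i => (hm.sub_const _).aemeasurable
  have hmean (i : Fin n) : ∫ x, S.indicator (1 : E → ℝ) (x i) ∂μ = Q.real S := by
    rw [← integral_indicator_one hS]
    have hi := (measurePreserving_eval (fun _ : Fin n => Q) i).map_eq
    rw [← hi, integral_map (measurable_pi_apply i).aemeasurable hm.aestronglyMeasurable]
  have hsub (i : Fin n) : HasSubgaussianMGF
      (fun x : Fin n → E => S.indicator (1 : E → ℝ) (x i) - Q.real S) ((‖(1 : ℝ) - 0‖₊ / 2) ^ 2) μ := by
    rw [← hmean i]
    refine hasSubgaussianMGF_of_mem_Icc (hm.comp (measurable_pi_apply i)).aemeasurable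
      (ae_of_all _ fun x => ?_)
    by_cases h : x i ∈ S <;> simp [h]
  have h := HasSubgaussianMGF.measure_sum_ge_le_of_iIndepFun hindep (s := Finset.univ)
    (fun i _ => hsub i) (ε := n * r) (by positivity)
  refine le_trans (measureReal_mono fun x hx => ?_) (h.trans (le_of_eq ?_))
  · simp only [Set.mem_ofPred_eq] at hx ⊢
    rw [empiricalProb_real_apply x hS, ← sub_nonneg] at hx
    rw [Finset.sum_sub_distrib]
    have := mul_nonneg hn.le hx
    rw [mul_sub, mul_add, ← mul_assoc, mul_inv_cancel₀ hn.ne', one_mul] at this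
    simp only [Finset.sum_const, Finset.card_univ, Fintype.card_fin, nsmul_eq_mul]
    linarith
  · congr 1
    simp
    field_simp

/-- A finitely valued map that moves each point of a union of finitely many balls of radius `ρ` by
less than `ρ`. -/
lemma exists_simpleFunc_dist_lt [MetricSpace E] [MeasurableSpace E] [OpensMeasurableSpace E]
    (x0 : E) (T : Finset E) (ρ : ℝ) :
    ∃ g : SimpleFunc E E, (∀ x, g x = x0 ∨ g x ∈ T) ∧
      ∀ x ∈ ⋃ t ∈ T, Metric.ball t ρ, dist x (g x) < ρ := by
  classical
  induction T using Finset.induction with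
  | empty => exact ⟨SimpleFunc.const E x0, by simp, by simp⟩
  | insert t T ht ih =>
    obtain ⟨g, h1, h2⟩ := ih
    refine ⟨SimpleFunc.piecewise (Metric.ball t ρ) Metric.isOpen_ball.measurableSet
      (SimpleFunc.const E t) g, fun x => ?_, fun x hx => ?_⟩
    · by_cases h : x ∈ Metric.ball t ρ
      · simp [SimpleFunc.piecewise_apply, h]
      · rcases h1 x with h' | h' <;> simp [SimpleFunc.piecewise_apply, h, h']
    · by_cases h : x ∈ Metric.ball t ρ
      · rw [SimpleFunc.piecewise_apply, if_pos h]
        exact h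
      · rw [SimpleFunc.piecewise_apply, if_neg h]
        apply h2
        simp only [Finset.mem_insert, Set.iUnion_iUnion_eq_or_left, Set.mem_union] at hx
        exact hx.resolve_left h

lemma exists_finset_card_eq_coveringNumber [MetricSpace E] {K : Set E} (hK : IsCompact K) {ε : ℝ}
    (hε : 0 < ε) :
    ∃ T : Finset E, T.card = coveringNumber K ε ∧ K ⊆ ⋃ x ∈ T, Metric.ball x ε := by
  have hne : {m | ∃ t : Finset E, t.card = m ∧ K ⊆ ⋃ x ∈ t, Metric.ball x ε}.Nonempty := by
    obtain ⟨t, ht, hKt⟩ := Metric.totallyBounded_iff.1 hK.totallyBounded ε hε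
    exact ⟨_, ht.toFinset, rfl, by simpa using hKt⟩
  exact Nat.sInf_mem hne

variable [MetricSpace E] [SecondCountableTopology E] [MeasurableSpace E] [BorelSpace E]
  {dbar : ProbabilityMeasure E → ProbabilityMeasure E → ℝ}

/-- Discretising by a map `g` that moves points by at most `η / 8`, the empirical measure is within
`η` of `Q` as soon as its frequencies on the sets `g ⁻¹' U` exceed those of `Q` by at most
`η / 4`. -/
lemma IsAdmissible.le_of_discretization (hd : IsAdmissible dbar) {Q : ProbabilityMeasure E}
    {K : Set E} (hQK : (Q : Measure E) Kᶜ = 0) {η : ℝ} (hη : 0 < η) {g : E → E}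
    (hg : Measurable g) (hgK : ∀ x ∈ K, dist x (g x) < η / 8) {n : ℕ} [NeZero n] {x : Fin n → E}
    (hx : ∀ i, x i ∈ K)
    (h : ∀ B, MeasurableSet B → (empiricalProb x : Measure E).real (g ⁻¹' B)
      ≤ (Q : Measure E).real (g ⁻¹' B) + η / 4) :
    dbar Q (empiricalProb x) ≤ η := by
  let Qg : ProbabilityMeasure E :=
    ⟨(Q : Measure E).map g, Measure.isProbabilityMeasure_map hg.aemeasurable⟩
  have h1 : dbar Q Qg ≤ η / 8 + 2 * 0 := by
    refine hd.averageLaw_le (n := 1) (Q : Measure E) (Y := fun _ e => e) (Y' := fun _ => g)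
      (fun _ => measurable_id) (fun _ => hg) ?_ ?_ (by positivity) fun _ => ?_
    · simp [averageLaw]
    · simp [averageLaw, Qg]
    · have h0 : (Q : Measure E) {z | η / 8 < dist z (g z)} = 0 :=
        measure_mono_null (fun z hz hzK => lt_asymm hz (hgK z hzK)) hQK
      simp [measureReal_def, h0]
  have h2 : dbar (empiricalProb fun i => g (x i)) (empiricalProb x) ≤ η / 8 + 2 * 0 := by
    refine hd.averageLaw_le (Measure.dirac ()) (fun _ => measurable_const)
      (fun _ => measurable_const) (coe_empiricalProb _) (coe_empiricalProb x) (by positivity)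
      fun i => ?_
    have h0 : ¬ η / 8 < dist (g (x i)) (x i) := by
      rw [dist_comm]
      exact not_lt.2 (hgK _ (hx i)).le
    simp [h0]
  have h3 : dbar (empiricalProb fun i => g (x i)) Qg ≤ 2 * (η / 4) := by
    refine hd.tv _ _ _ fun B hB => ?_
    have e1 : (empiricalProb (fun i => g (x i)) : Measure E).real B
        = (empiricalProb x : Measure E).real (g ⁻¹' B) := by
      rw [empiricalProb_real_apply _ hB, empiricalProb_real_apply _ (hg hB)]
      rfl
    have e2 : (Qg : Measure E).real B = (Q : Measure E).real (g ⁻¹' B) :=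
      map_measureReal_apply hg hB
    rw [e1, e2]
    exact h B hB
  have h4 := hd.triangle Q Qg (empiricalProb x)
  have h5 := hd.triangle Qg (empiricalProb fun i => g (x i)) (empiricalProb x)
  rw [hd.symm Qg (empiricalProb fun i => g (x i))] at h5
  linarith

/-- Deviations of the empirical measure of a law carried by a compact set: Hoeffding's inequality
and a union bound over the unions of cells of a partition subordinate to a covering by balls of
radius `η / 8`. -/
lemma measureReal_dbar_empiricalProb_gt_le (hd : IsAdmissible dbar) {Q : ProbabilityMeasure E}
    {K : Set E} (hK : IsCompact K) (hQK : (Q : Measure E) Kᶜ = 0) {η : ℝ} (hη : 0 < η)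
    (n : ℕ) [NeZero n] :
    (Measure.pi fun _ : Fin n => (Q : Measure E)).real {x | η < dbar Q (empiricalProb x)}
      ≤ 2 ^ (coveringNumber K (η / 8) + 1) * Real.exp (-(n * η ^ 2 / 8)) := by
  classical
  obtain ⟨x0⟩ : Nonempty E := (Q : Measure E).nonempty_of_neZero
  obtain ⟨T, hT, hKT⟩ := exists_finset_card_eq_coveringNumber hK (show 0 < η / 8 by positivity)
  obtain ⟨g, hgT, hgd⟩ := exists_simpleFunc_dist_lt x0 T (η / 8)
  set μ := Measure.pi fun _ : Fin n => (Q : Measure E) with hμ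
  let 𝒰 : Finset (Finset E) := (insert x0 T).powerset
  let bad : Finset E → Set (Fin n → E) := fun U =>
    {x | (Q : Measure E).real (g ⁻¹' U) + η / 4 ≤ (empiricalProb x : Measure E).real (g ⁻¹' U)}
  have hnull : ∀ᵐ x ∂μ, ∀ i, x i ∈ K := by
    rw [ae_all_iff]
    intro i
    exact (measurePreserving_eval (fun _ : Fin n => (Q : Measure E)) i).quasiMeasurePreserving.ae
      (p := fun e => e ∈ K) (by rwa [ae_iff])
  have hsub : {x | η < dbar Q (empiricalProb x)} ≤ᵐ[μ] ⋃ U ∈ 𝒰, bad U := by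
    filter_upwards [hnull] with x hxK
    change x ∈ {x | η < dbar Q (empiricalProb x)} → x ∈ ⋃ U ∈ 𝒰, bad U
    intro hx
    by_contra hcon
    refine not_le.2 hx (hd.le_of_discretization hQK hη g.measurable (fun z hz => hgd z (hKT hz)) hxK
      fun B hB => ?_)
    have hpre : g ⁻¹' B = g ⁻¹' ((insert x0 T).filter (· ∈ B) : Finset E) := by
      ext z
      rcases hgT z with h | h <;> simp [h]
    simp only [Set.mem_iUnion, not_exists] at hcon
    have hc := hcon ((insert x0 T).filter (· ∈ B)) (by simp [𝒰, Finset.filter_subset])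
    simp only [bad, Set.mem_ofPred_eq, not_le] at hc
    rw [hpre]
    exact hc.le
  have hbad (U : Finset E) : μ.real (bad U) ≤ Real.exp (-(n * η ^ 2 / 8)) := by
    refine (measureReal_empiricalProb_ge_le (Q : Measure E) (g.measurableSet_preimage _)
      (by positivity)).trans (le_of_eq ?_)
    congr 1
    ring
  calc μ.real {x | η < dbar Q (empiricalProb x)} ≤ μ.real (⋃ U ∈ 𝒰, bad U) :=
        ENNReal.toReal_mono (measure_ne_top _ _) (measure_mono_ae hsub)
    _ ≤ ∑ U ∈ 𝒰, μ.real (bad U) := measureReal_biUnion_finset_le _ _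
    _ ≤ ∑ _U ∈ 𝒰, Real.exp (-(n * η ^ 2 / 8)) := Finset.sum_le_sum fun U _ => hbad U
    _ = 2 ^ (insert x0 T).card * Real.exp (-(n * η ^ 2 / 8)) := by simp [𝒰, Finset.card_powerset]
    _ ≤ _ := by
        gcongr
        · norm_num
        · rw [← hT]; exact Finset.card_insert_le _ _

end

open InformationTheory

/-! ### Strict convexity of the relative entropy -/

section

variable {E : Type*}

section KLFun

/-- A Pinsker-type lower bound near the minimum of `klFun`. -/
lemma sq_sub_one_div_six_le_klFun {x : ℝ} (h0 : 0 ≤ x) (h2 : x ≤ 2) :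
    (x - 1) ^ 2 / 6 ≤ klFun x := by
  obtain ⟨y, hy, rfl⟩ : ∃ y : ℝ, 0 ≤ y ∧ x = y ^ 2 := ⟨√x, Real.sqrt_nonneg x, (Real.sq_sqrt h0).symm⟩
  -- Comparison with the Hellinger integrand `(√x - 1) ^ 2`.
  have h1 : (y - 1) ^ 2 ≤ klFun (y ^ 2) := by
    rw [klFun_apply, Real.log_pow]
    rcases hy.eq_or_lt with rfl | hpos
    · simp
    · have := mul_le_mul_of_nonneg_left (Real.one_sub_inv_le_log_of_pos hpos) (sq_nonneg y)
      have e : y ^ 2 * (1 - y⁻¹) = y ^ 2 - y := by field_simp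
      rw [e] at this
      push_cast
      nlinarith
  have h3 : (y + 1) ^ 2 ≤ 6 := by nlinarith [sq_nonneg (y - 3 / 2)]
  have h4 : (y ^ 2 - 1) ^ 2 = (y + 1) ^ 2 * (y - 1) ^ 2 := by ring
  have := mul_le_mul_of_nonneg_right h3 (sq_nonneg (y - 1))
  linarith

lemma mul_klFun_div {x w : ℝ} (hx : 0 ≤ x) (hw : 0 < w) :
    w * klFun (x / w) = x * Real.log x - x * Real.log w + w - x := by
  rcases hx.eq_or_lt with rfl | hx
  · simp [klFun_zero]
  · rw [klFun_apply, Real.log_div hx.ne' hw.ne']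
    field_simp

/-- A quantitative form of the strict convexity of `klFun`. -/
lemma abs_sub_le_klFun_midpoint {u v s : ℝ} (hu : 0 ≤ u) (hv : 0 ≤ v) :
    2 * s * |u - v| ≤ 2 * s ^ 2 * (u + v)
      + 3 * (klFun u + klFun v - 2 * klFun ((u + v) / 2)) := by
  rcases (add_nonneg hu hv).eq_or_lt with h | h
  · have hu0 : u = 0 := by linarith
    have hv0 : v = 0 := by linarith
    norm_num [hu0, hv0, klFun_zero]
  · set w := (u + v) / 2 with hw
    have hwpos : 0 < w := by positivity
    have hsum : klFun u + klFun v - 2 * klFun w = w * klFun (u / w) + w * klFun (v / w) := by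
      rw [mul_klFun_div hu hwpos, mul_klFun_div hv hwpos, klFun_apply, klFun_apply, klFun_apply]
      have : u + v = 2 * w := by rw [hw]; ring
      linear_combination Real.log w * this
    have h1 := sq_sub_one_div_six_le_klFun (x := u / w) (by positivity)
      ((div_le_iff₀ hwpos).2 (by rw [hw]; linarith))
    have h2 := sq_sub_one_div_six_le_klFun (x := v / w) (by positivity)
      ((div_le_iff₀ hwpos).2 (by rw [hw]; linarith))
    have h3 : |u - v| ^ 2 / (2 * (u + v)) ≤
        3 * (klFun u + klFun v - 2 * klFun w) := by
      rw [hsum]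
      have e : |u - v| ^ 2 / (2 * (u + v))
          = 3 * (w * ((u / w - 1) ^ 2 / 6) + w * ((v / w - 1) ^ 2 / 6)) := by
        rw [sq_abs, hw]
        field_simp
        ring
      rw [e]
      gcongr
    have h4 : 2 * s * |u - v| ≤ 2 * s ^ 2 * (u + v) + |u - v| ^ 2 / (2 * (u + v)) := by
      have e : 2 * s ^ 2 * (u + v) + |u - v| ^ 2 / (2 * (u + v)) - 2 * s * |u - v|
          = (2 * s * (u + v) - |u - v|) ^ 2 / (2 * (u + v)) := by
        field_simp
        ring
      have : 0 ≤ (2 * s * (u + v) - |u - v|) ^ 2 / (2 * (u + v)) := by positivity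
      linarith
    linarith

end KLFun

section Density

variable [MeasurableSpace E]

/-- The real-valued density of `β` with respect to `α`. -/
def density (β α : ProbabilityMeasure E) (x : E) : ℝ :=
  ((β : Measure E).rnDeriv (α : Measure E) x).toReal

variable {α β : ProbabilityMeasure E}

lemma density_nonneg (x : E) : 0 ≤ density β α x := ENNReal.toReal_nonneg

lemma measurable_density : Measurable (density β α) :=
  (Measure.measurable_rnDeriv _ _).ennreal_toReal

lemma integrable_density : Integrable (density β α) (α : Measure E) :=
  Measure.integrable_toReal_rnDeriv

lemma ac_of_klDiv_ne_top (h : klDiv (β : Measure E) (α : Measure E) ≠ ∞) :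
    (β : Measure E) ≪ (α : Measure E) := (klDiv_ne_top_iff.1 h).1

lemma setIntegral_density (h : klDiv (β : Measure E) (α : Measure E) ≠ ∞) (B : Set E) :
    ∫ x in B, density β α x ∂(α : Measure E) = (β : Measure E).real B :=
  Measure.setIntegral_toReal_rnDeriv (ac_of_klDiv_ne_top h) B

lemma integral_density (h : klDiv (β : Measure E) (α : Measure E) ≠ ∞) :
    ∫ x, density β α x ∂(α : Measure E) = 1 := by
  simpa using setIntegral_density h Set.univ

lemma integrable_klFun_density (h : klDiv (β : Measure E) (α : Measure E) ≠ ∞) :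
    Integrable (fun x => klFun (density β α x)) (α : Measure E) :=
  (integrable_klFun_rnDeriv_iff (ac_of_klDiv_ne_top h)).2 (klDiv_ne_top_iff.1 h).2

lemma toReal_klDiv_eq (h : (β : Measure E) ≪ (α : Measure E)) :
    (klDiv (β : Measure E) (α : Measure E)).toReal
      = ∫ x, klFun (density β α x) ∂(α : Measure E) :=
  toReal_klDiv_eq_integral_klFun h

lemma density_withDensity {u : E → ℝ} (hu : Measurable u) (hu0 : 0 ≤ u)
    (hβ : (β : Measure E) = (α : Measure E).withDensity fun x => ENNReal.ofReal (u x)) :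
    density β α =ᵐ[(α : Measure E)] u := by
  have := Measure.rnDeriv_withDensity (α : Measure E) hu.ennreal_ofReal
  filter_upwards [this] with x hx
  rw [density, hβ, hx, ENNReal.toReal_ofReal (hu0 x)]

/-- Almost minimisers of the entropy over a convex set are close in total variation: the midpoint
belongs to the set, and its entropy would be too small otherwise. -/
lemma integral_abs_density_sub_le {D : Set (ProbabilityMeasure E)} (hD : IsConvexSet D)
    {μ ν : ProbabilityMeasure E} (hμD : μ ∈ D) (hνD : ν ∈ D) {h s : ℝ} (hs : 0 < s)
    (hlow : ∀ κ ∈ D, klDiv (κ : Measure E) (α : Measure E) ≠ ∞ →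
      h ≤ (klDiv (κ : Measure E) (α : Measure E)).toReal)
    (hμ : klDiv (μ : Measure E) (α : Measure E) ≠ ∞)
    (hν : klDiv (ν : Measure E) (α : Measure E) ≠ ∞)
    (hμh : (klDiv (μ : Measure E) (α : Measure E)).toReal ≤ h + s ^ 2)
    (hνh : (klDiv (ν : Measure E) (α : Measure E)).toReal ≤ h + s ^ 2) :
    ∫ x, |density μ α x - density ν α x| ∂(α : Measure E) ≤ 5 * s := by
  obtain ⟨κ, hκ⟩ := exists_mixture μ ν (a := 1 / 2) (b := 1 / 2) (by norm_num)
  have hκD : κ ∈ D := hD μ hμD ν hνD _ _ (by norm_num) κ hκ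
  have hκac : (κ : Measure E) ≪ (α : Measure E) := by
    rw [hκ]
    exact ((ac_of_klDiv_ne_top hμ).smul_left _).add_left ((ac_of_klDiv_ne_top hν).smul_left _)
  have hdens : ∀ᵐ x ∂(α : Measure E),
      density κ α x = (density μ α x + density ν α x) / 2 := by
    have h1 := Measure.rnDeriv_add' ((1 / 2 : ℝ≥0) • (μ : Measure E))
      ((1 / 2 : ℝ≥0) • (ν : Measure E)) (α : Measure E)
    have h2 := Measure.rnDeriv_smul_left' (μ : Measure E) (α : Measure E) (1 / 2)
    have h3 := Measure.rnDeriv_smul_left' (ν : Measure E) (α : Measure E) (1 / 2)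
    filter_upwards [h1, h2, h3, Measure.rnDeriv_lt_top (μ : Measure E) (α : Measure E),
      Measure.rnDeriv_lt_top (ν : Measure E) (α : Measure E)] with x h1 h2 h3 h4 h5
    rw [density, hκ, h1, Pi.add_apply, h2, h3, Pi.smul_apply, Pi.smul_apply]
    simp only [ENNReal.smul_def, smul_eq_mul, density]
    rw [ENNReal.toReal_add (by finiteness) (by finiteness), ENNReal.toReal_mul, ENNReal.toReal_mul]
    simp
    ring
  have hiμ := integrable_klFun_density hμ
  have hiν := integrable_klFun_density hν
  have hw0 (x : E) : 0 ≤ (density μ α x + density ν α x) / 2 := by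
    have := density_nonneg (β := μ) (α := α) x
    have := density_nonneg (β := ν) (α := α) x
    positivity
  have hiw : Integrable (fun x => klFun ((density μ α x + density ν α x) / 2)) (α : Measure E) := by
    refine ((hiμ.add hiν).div_const 2).mono'
      (measurable_klFun.comp ((measurable_density.add measurable_density).div_const 2)
        ).aestronglyMeasurable (ae_of_all _ fun x => ?_)
    have h1 := abs_sub_le_klFun_midpoint (s := 0) (density_nonneg (β := μ) (α := α) x)
      (density_nonneg (β := ν) (α := α) x)
    simp only [mul_zero, zero_mul, ne_eq, OfNat.ofNat_ne_zero, not_false_eq_true, zero_pow,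
      zero_add] at h1
    rw [Real.norm_of_nonneg (klFun_nonneg (hw0 x))]
    simp only [Pi.add_apply]
    linarith
  have hκi : Integrable (fun x => klFun (density κ α x)) (α : Measure E) :=
    hiw.congr (by filter_upwards [hdens] with x hx; rw [hx])
  have hκne : klDiv (κ : Measure E) (α : Measure E) ≠ ∞ :=
    klDiv_ne_top hκac ((integrable_klFun_rnDeriv_iff hκac).1 hκi)
  have hκh := hlow κ hκD hκne
  rw [toReal_klDiv_eq hκac, integral_congr_ae (g := fun x =>
    klFun ((density μ α x + density ν α x) / 2))
    (by filter_upwards [hdens] with x hx; rw [hx])] at hκh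
  rw [toReal_klDiv_eq (ac_of_klDiv_ne_top hμ)] at hμh
  rw [toReal_klDiv_eq (ac_of_klDiv_ne_top hν)] at hνh
  have i1 : Integrable (fun x => density μ α x + density ν α x) (α : Measure E) :=
    integrable_density.add integrable_density
  have i2 : Integrable (fun x => klFun (density μ α x) + klFun (density ν α x)) (α : Measure E) :=
    hiμ.add hiν
  have i3 : Integrable (fun x => klFun (density μ α x) + klFun (density ν α x)
      - 2 * klFun ((density μ α x + density ν α x) / 2)) (α : Measure E) :=
    i2.sub (hiw.const_mul 2)
  have hint : ∫ x, 2 * s * |density μ α x - density ν α x| ∂(α : Measure E)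
      ≤ ∫ x, (2 * s ^ 2 * (density μ α x + density ν α x)
        + 3 * (klFun (density μ α x) + klFun (density ν α x)
          - 2 * klFun ((density μ α x + density ν α x) / 2))) ∂(α : Measure E) :=
    integral_mono ((integrable_density.sub integrable_density).abs.const_mul _)
      ((i1.const_mul _).add (i3.const_mul 3)) fun x =>
        abs_sub_le_klFun_midpoint (density_nonneg x) (density_nonneg x)
  rw [integral_const_mul, integral_add (i1.const_mul _) (i3.const_mul 3), integral_const_mul,
    integral_const_mul, integral_add integrable_density integrable_density,
    integral_sub i2 (hiw.const_mul 2), integral_const_mul, integral_add hiμ hiν,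
    integral_density hμ, integral_density hν] at hint
  have hfin : 2 * s * ∫ x, |density μ α x - density ν α x| ∂(α : Measure E)
      ≤ 2 * s * (5 * s) := by
    nlinarith
  exact le_of_mul_le_mul_left hfin (by positivity)

lemma abs_measureReal_sub_le_integral_density {μ ν : ProbabilityMeasure E}
    (hμ : klDiv (μ : Measure E) (α : Measure E) ≠ ∞)
    (hν : klDiv (ν : Measure E) (α : Measure E) ≠ ∞) (B : Set E) :
    |(μ : Measure E).real B - (ν : Measure E).real B|
      ≤ ∫ x, |density μ α x - density ν α x| ∂(α : Measure E) := by
  rw [← setIntegral_density hμ, ← setIntegral_density hν,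
    ← integral_sub integrable_density.integrableOn integrable_density.integrableOn]
  refine (abs_integral_le_integral_abs).trans ?_
  exact setIntegral_le_integral (integrable_density.sub integrable_density).abs
    (ae_of_all _ fun x => abs_nonneg _)

end Density

section Completeness

/-- Completeness of `L¹`, together with the almost everywhere convergence of a subsequence. -/
lemma exists_L1_limit [MeasurableSpace E] {α : Measure E} {u : ℕ → E → ℝ}
    (hu : ∀ m, Integrable (u m) α)
    (hc : ∀ r > 0, ∃ N, ∀ m ≥ N, ∀ l ≥ N, ∫ x, |u m x - u l x| ∂α ≤ r) :
    ∃ U : E → ℝ, Measurable U ∧ Integrable U α ∧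
      Tendsto (fun m => ∫ x, |u m x - U x| ∂α) atTop (𝓝 0) ∧
      ∃ ns : ℕ → ℕ, StrictMono ns ∧ ∀ᵐ x ∂α, Tendsto (fun i => u (ns i) x) atTop (𝓝 (U x)) := by
  let f : ℕ → Lp ℝ 1 α := fun m => (hu m).toL1
  have hf (m) : f m =ᵐ[α] u m := (hu m).coeFn_toL1
  have hdist (m l) : dist (f m) (f l) = ∫ x, |u m x - u l x| ∂α := by
    rw [L1.dist_eq_integral_dist]
    refine integral_congr_ae ?_
    filter_upwards [hf m, hf l] with x h1 h2
    rw [h1, h2, Real.dist_eq]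
  have hcauchy : CauchySeq f := by
    rw [Metric.cauchySeq_iff]
    intro r hr
    obtain ⟨N, hN⟩ := hc (r / 2) (half_pos hr)
    exact ⟨N, fun m hm l hl => by rw [hdist]; linarith [hN m hm l hl]⟩
  obtain ⟨F, hF⟩ := cauchySeq_tendsto_of_complete hcauchy
  have hFm := Lp.stronglyMeasurable F
  refine ⟨F, hFm.measurable, L1.integrable_coeFn F, ?_, ?_⟩
  · rw [tendsto_iff_dist_tendsto_zero] at hF
    refine hF.congr fun m => ?_
    rw [L1.dist_eq_integral_dist]
    refine integral_congr_ae ?_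
    filter_upwards [hf m] with x h1
    rw [h1, Real.dist_eq]
  · obtain ⟨ns, hns, h⟩ := (tendstoInMeasure_of_tendsto_Lp hF).exists_seq_tendsto_ae
    refine ⟨ns, hns, ?_⟩
    have hall : ∀ᵐ x ∂α, ∀ m, f m x = u m x := ae_all_iff.2 hf
    filter_upwards [h, hall] with x h1 h2
    simpa [h2] using h1

end Completeness

end

/-! ### Entropy of thin enlargements -/

section

variable {E : Type*} [MetricSpace E] [MeasurableSpace E] [BorelSpace E]
  {dbar : ProbabilityMeasure E → ProbabilityMeasure E → ℝ} {C : Set (ProbabilityMeasure E)}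
  {α : ProbabilityMeasure E}

omit [MetricSpace E] [BorelSpace E] in
lemma toReal_relEntropy_le {D : Set (ProbabilityMeasure E)} {β : ProbabilityMeasure E} (hβ : β ∈ D)
    (h : klDiv (β : Measure E) (α : Measure E) ≠ ∞) :
    (relEntropy D α).toReal ≤ (klDiv (β : Measure E) (α : Measure E)).toReal :=
  ENNReal.toReal_mono h (iInf₂_le β hβ)

omit [MetricSpace E] [BorelSpace E] in
/-- Convergence of densities in `L¹(α)` and almost everywhere along a subsequence: the limit is a
probability density, and the entropy is lower semicontinuous. -/
lemma exists_limit_of_density_cauchy {ν : ℕ → ProbabilityMeasure E} {c : ℝ} {b : ℕ → ℝ}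
    (hν : ∀ m, klDiv (ν m : Measure E) (α : Measure E) ≠ ∞)
    (hb : Tendsto b atTop (𝓝 c))
    (hνb : ∀ m, (klDiv (ν m : Measure E) (α : Measure E)).toReal ≤ b m)
    (hc : ∀ r > 0, ∃ N, ∀ m ≥ N, ∀ l ≥ N,
      ∫ x, |density (ν m) α x - density (ν l) α x| ∂(α : Measure E) ≤ r) :
    ∃ β : ProbabilityMeasure E, klDiv (β : Measure E) (α : Measure E) ≠ ∞ ∧
      (klDiv (β : Measure E) (α : Measure E)).toReal ≤ c ∧
      Tendsto (fun m => ∫ x, |density (ν m) α x - density β α x| ∂(α : Measure E)) atTop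
        (𝓝 0) := by
  obtain ⟨U, hUm, hUi, hU, ns, hns, hae⟩ := exists_L1_limit (fun m => integrable_density) hc
  have hU0 : ∀ᵐ x ∂(α : Measure E), 0 ≤ U x := by
    filter_upwards [hae] with x hx
    exact ge_of_tendsto' hx fun i => density_nonneg x
  have hUint : ∫ x, U x ∂(α : Measure E) = 1 := by
    have h1 : Tendsto (fun m => ∫ x, density (ν m) α x ∂(α : Measure E)) atTop
        (𝓝 (∫ x, U x ∂(α : Measure E))) := by
      rw [tendsto_iff_dist_tendsto_zero]
      refine squeeze_zero (fun _ => dist_nonneg) (fun m => ?_) hU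
      rw [Real.dist_eq, ← integral_sub integrable_density hUi]
      exact abs_integral_le_integral_abs
    simp only [integral_density (hν _)] at h1
    exact tendsto_nhds_unique h1 tendsto_const_nhds
  have hprob : IsProbabilityMeasure
      ((α : Measure E).withDensity fun x => ENNReal.ofReal (max (U x) 0)) := ⟨by
    rw [withDensity_apply _ MeasurableSet.univ, Measure.restrict_univ,
      lintegral_congr_ae (g := fun x => ENNReal.ofReal (U x))
        (by filter_upwards [hU0] with x hx; rw [max_eq_left hx]),
      ← ofReal_integral_eq_lintegral_ofReal hUi hU0, hUint, ENNReal.ofReal_one]⟩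
  let β : ProbabilityMeasure E := ⟨_, hprob⟩
  have hdens : density β α =ᵐ[(α : Measure E)] U := by
    filter_upwards [density_withDensity (hUm.max measurable_const) (fun x => le_max_right _ _)
      (β := β) rfl, hU0] with x h1 h2
    exact h1.trans (max_eq_left h2)
  have hac : (β : Measure E) ≪ (α : Measure E) := withDensity_absolutelyContinuous _ _
  have hkl : klDiv (β : Measure E) (α : Measure E) ≤ ENNReal.ofReal c := by
    have hF := lintegral_liminf_le (μ := (α : Measure E)) (u := atTop)
      (f := fun i x => ENNReal.ofReal (klFun (density (ν (ns i)) α x)))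
      (fun i => (measurable_klFun.comp measurable_density).ennreal_ofReal)
    have h1 : klDiv (β : Measure E) (α : Measure E) = ∫⁻ x, liminf
        (fun i => ENNReal.ofReal (klFun (density (ν (ns i)) α x))) atTop ∂(α : Measure E) := by
      rw [klDiv_eq_lintegral_klFun_of_ac hac]
      refine lintegral_congr_ae ?_
      filter_upwards [hdens, hae] with x h1 h2
      have h3 : Tendsto (fun i => ENNReal.ofReal (klFun (density (ν (ns i)) α x))) atTop
          (𝓝 (ENNReal.ofReal (klFun (U x)))) :=
        ENNReal.tendsto_ofReal ((continuous_klFun.tendsto _).comp h2)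
      rw [h3.liminf_eq, ← h1]
      rfl
    rw [h1]
    refine hF.trans ?_
    have h2 : Tendsto (fun i => ENNReal.ofReal (b (ns i))) atTop (𝓝 (ENNReal.ofReal c)) :=
      ENNReal.tendsto_ofReal (hb.comp hns.tendsto_atTop)
    rw [← h2.liminf_eq]
    refine liminf_le_liminf (Eventually.of_forall fun i => ?_)
    have h3 := klDiv_eq_lintegral_klFun_of_ac (ac_of_klDiv_ne_top (hν (ns i)))
    change ∫⁻ x, ENNReal.ofReal (klFun ((ν (ns i) : Measure E).rnDeriv (α : Measure E) x).toReal)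
      ∂(α : Measure E) ≤ _
    rw [← h3, ← ENNReal.ofReal_toReal (hν (ns i))]
    exact ENNReal.ofReal_le_ofReal (hνb _)
  have hc0 : 0 ≤ c := ge_of_tendsto' hb fun m => ENNReal.toReal_nonneg.trans (hνb m)
  refine ⟨β, (hkl.trans_lt ENNReal.ofReal_lt_top).ne, ENNReal.toReal_le_of_le_ofReal hc0 hkl, ?_⟩
  refine hU.congr fun m => integral_congr_ae ?_
  filter_upwards [hdens] with x hx
  rw [hx]

/-- The entropy of the enlargements of a closed convex set converges to that of the set. Almost
minimisers over the enlargements form a Cauchy sequence in total variation, by strict convexity; the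
limit belongs to the set, and the entropy is lower semicontinuous. -/
lemma exists_enlargement_entropy_ge (hd : IsAdmissible dbar) (hC : C.Nonempty)
    (hclosed : IsClosed C) (hconv : IsConvexSet C) {δ : ℝ} (hδ : 0 < δ) :
    ∃ ε > 0, ∀ ν ∈ enlargement dbar C ε, klDiv (ν : Measure E) (α : Measure E) ≠ ∞ →
      (relEntropy C α).toReal - δ ≤ (klDiv (ν : Measure E) (α : Measure E)).toReal := by
  by_contra! hcon
  set h := (relEntropy C α).toReal with hh
  let ρ : ℕ → ℝ := fun m => 1 / ((m : ℝ) + 1)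
  have hρ (m : ℕ) : 0 < ρ m := by positivity
  have hρ0 : Tendsto ρ atTop (𝓝 0) := tendsto_one_div_add_atTop_nhds_zero_nat
  let a : ℕ → ℝ := fun m => (relEntropy (enlargement dbar C (ρ m)) α).toReal
  have hfin (m : ℕ) : relEntropy (enlargement dbar C (ρ m)) α ≠ ∞ := by
    obtain ⟨ν, hν, h1, -⟩ := hcon (ρ m) (hρ m)
    exact ne_top_of_le_ne_top h1 (iInf₂_le ν hν)
  have ha (m : ℕ) : a m ≤ h - δ := by
    obtain ⟨ν, hν, h1, h2⟩ := hcon (ρ m) (hρ m)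
    exact (toReal_relEntropy_le hν h1).trans h2.le
  have hmono : Monotone a := by
    intro m l hml
    refine ENNReal.toReal_mono (hfin l) ?_
    refine biInf_mono fun ν hν => enlargement_mono ?_ hν
    exact one_div_le_one_div_of_le (by positivity) (by gcongr)
  obtain ⟨c, hac⟩ : ∃ c, Tendsto a atTop (𝓝 c) :=
    ⟨_, tendsto_atTop_ciSup hmono ⟨h - δ, by rintro _ ⟨m, rfl⟩; exact ha m⟩⟩
  have hcle : c ≤ h - δ := le_of_tendsto' hac ha
  have hale (m : ℕ) : a m ≤ c := hmono.ge_of_tendsto hac m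
  have hexists (m : ℕ) : ∃ ν ∈ enlargement dbar C (ρ m),
      klDiv (ν : Measure E) (α : Measure E) ≠ ∞ ∧
      (klDiv (ν : Measure E) (α : Measure E)).toReal ≤ a m + ρ m := by
    have h1 : relEntropy (enlargement dbar C (ρ m)) α < ENNReal.ofReal (a m + ρ m) := by
      rw [← ENNReal.ofReal_toReal (hfin m)]
      exact (ENNReal.ofReal_lt_ofReal_iff_of_nonneg ENNReal.toReal_nonneg).2
        (lt_add_of_pos_right _ (hρ m))
    simp only [relEntropy, iInf_lt_iff] at h1
    obtain ⟨ν, hν, h2⟩ := h1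
    refine ⟨ν, hν, (h2.trans ENNReal.ofReal_lt_top).ne, ENNReal.toReal_le_of_le_ofReal ?_ h2.le⟩
    exact add_nonneg ENNReal.toReal_nonneg (hρ m).le
  choose ν hνmem hνfin hνle using hexists
  have hνc (m : ℕ) : (klDiv (ν m : Measure E) (α : Measure E)).toReal ≤ c + ρ m :=
    (hνle m).trans (by gcongr; exact hale m)
  obtain ⟨β, hβfin, hβle, hβlim⟩ := exists_limit_of_density_cauchy (c := c)
    (b := fun m => c + ρ m) hνfin (by simpa using hρ0.const_add c) hνc (by
      intro r hr
      set s := r / 5 with hs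
      have hs0 : 0 < s := by positivity
      have hev : ∀ᶠ m in atTop, c + ρ m ≤ a m + s ^ 2 := by
        have h1 : Tendsto (fun m => c + ρ m - a m) atTop (𝓝 0) := by
          simpa using (hρ0.const_add c).sub hac
        filter_upwards [h1.eventually_le_const (show (0 : ℝ) < s ^ 2 by positivity)] with m hm
        linarith
      obtain ⟨N, hN⟩ := hev.exists
      have hρN (m : ℕ) (hm : N ≤ m) : ρ m ≤ ρ N :=
        one_div_le_one_div_of_le (by positivity) (by gcongr)
      refine ⟨N, fun m hm l hl => ?_⟩
      have := integral_abs_density_sub_le (isConvexSet_enlargement hd hC hconv (ρ N))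
        (enlargement_mono (hρN m hm) (hνmem m)) (enlargement_mono (hρN l hl) (hνmem l)) hs0
        (h := a N) (fun κ hκ hκfin => toReal_relEntropy_le hκ hκfin) (hνfin m) (hνfin l)
        (by linarith [hνc m, hρN m hm]) (by linarith [hνc l, hρN l hl])
      calc _ ≤ 5 * s := this
        _ = r := by rw [hs]; ring)
  have hβC : β ∈ C := by
    have hμ (m : ℕ) : ∃ μ ∈ C, dbar μ (ν m) < ρ m + ρ m :=
      (mem_enlargement_iff hd hC).1 (hνmem m) (ρ m) (hρ m)
    choose μ hμC hμd using hμ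
    have hlim : Tendsto (fun m => dbar (μ m) β) atTop (𝓝 0) := by
      refine squeeze_zero (fun m => hd.nonneg _ _) (fun m => ?_)
        (g := fun m => ρ m + ρ m
          + 2 * ∫ x, |density (ν m) α x - density β α x| ∂(α : Measure E)) ?_
      · have h1 := hd.triangle (μ m) (ν m) β
        have h2 : dbar (ν m) β
            ≤ 2 * ∫ x, |density (ν m) α x - density β α x| ∂(α : Measure E) := by
          refine hd.tv _ _ _ fun B _ => ?_
          have := abs_le.1 (abs_measureReal_sub_le_integral_density (hνfin m) hβfin B)
          linarith
        linarith [hμd m]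
      · simpa using (hρ0.add hρ0).add (hβlim.const_mul 2)
    exact hclosed.mem_of_tendsto (hd.tendsto _ _ hlim) (Eventually.of_forall hμC)
  have := toReal_relEntropy_le hβC hβfin
  linarith

/-- Almost minimisers of the entropy over a thin enlargement of a closed convex set are close to
the `I`-projection in total variation. -/
lemma exists_enlargement_close_to_projection (hd : IsAdmissible dbar) (hclosed : IsClosed C)
    (hconv : IsConvexSet C) (hent : relEntropy C α ≠ ∞) {αs : ProbabilityMeasure E}
    (hαs : IsIProjection C α αs) {r : ℝ} (hr : 0 < r) :
    ∃ ε > 0, ∀ ν ∈ enlargement dbar C ε, klDiv (ν : Measure E) (α : Measure E) ≠ ∞ →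
      (klDiv (ν : Measure E) (α : Measure E)).toReal ≤ (relEntropy C α).toReal + ε →
      ∀ B, |(ν : Measure E).real B - (αs : Measure E).real B| ≤ r := by
  set s := r / 5 with hs
  have hs0 : 0 < s := by positivity
  have hC : C.Nonempty := ⟨αs, hαs.1⟩
  obtain ⟨ε, hε, h1⟩ := exists_enlargement_entropy_ge hd hC hclosed hconv
    (show 0 < s ^ 2 / 2 by positivity)
  have hfin : klDiv (αs : Measure E) (α : Measure E) ≠ ∞ := by rwa [hαs.2]
  refine ⟨min ε (s ^ 2 / 2), by positivity, fun ν hν hνfin hνle B => ?_⟩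
  have h2 := enlargement_mono (min_le_left ε (s ^ 2 / 2)) hν
  refine (abs_measureReal_sub_le_integral_density hνfin hfin B).trans ?_
  have h3 : (0 : ℝ) ≤ ε := hε.le
  have hself : αs ∈ enlargement dbar C ε := by
    refine mem_enlargement_of_le hd hαs.1 ?_
    have := hd.tv αs αs 0 (by simp)
    linarith
  have := integral_abs_density_sub_le (isConvexSet_enlargement hd hC hconv ε) h2 hself hs0
    (h := (relEntropy C α).toReal - s ^ 2 / 2) h1 hνfin hfin
    (by linarith [min_le_right ε (s ^ 2 / 2)]) (by rw [hαs.2]; nlinarith)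
  calc _ ≤ 5 * s := this
    _ = r := by rw [hs]; ring

end

/-! ### Relative entropy of product laws -/

section

variable {E : Type*} [MeasurableSpace E]

section Power

/-- The law of `n` independent variables of law `Q`. -/
def powProb (n : ℕ) (Q : ProbabilityMeasure E) : ProbabilityMeasure (Fin n → E) :=
  ⟨Measure.pi fun _ => (Q : Measure E), inferInstance⟩

lemma coe_powProb (n : ℕ) (Q : ProbabilityMeasure E) :
    (powProb n Q : Measure (Fin n → E)) = Measure.pi fun _ => (Q : Measure E) := rfl

lemma map_eval_powProb {n : ℕ} (Q : ProbabilityMeasure E) (i : Fin n) :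
    (powProb n Q : Measure (Fin n → E)).map (fun x => x i) = (Q : Measure E) :=
  (measurePreserving_eval (fun _ : Fin n => (Q : Measure E)) i).map_eq

/-- Coordinates of a product law along an injection of the index sets. -/
lemma map_comp_pi {ι κ : Type*} [Fintype ι] [Fintype κ] (Q : Measure E) [IsProbabilityMeasure Q]
    {e : κ → ι} (he : e.Injective) :
    (Measure.pi fun _ : ι => Q).map (fun x j => x (e j)) = Measure.pi fun _ : κ => Q := by
  have h1 : iIndepFun (fun (i : ι) (x : ι → E) => x i) (Measure.pi fun _ : ι => Q) :=
    iIndepFun_pi (μ := fun _ : ι => Q) (X := fun _ e => e) fun _ => aemeasurable_id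
  rw [(h1.precomp he).map_fun_eq_pi_map fun j => (measurable_pi_apply _).aemeasurable]
  congr 1
  funext j
  exact (measurePreserving_eval (fun _ : ι => Q) (e j)).map_eq

/-- Independence of disjoint blocks of coordinates. -/
lemma integral_prod_blocks {ι κ τ : Type*} [Fintype ι] [Fintype κ] [Fintype τ] (Q : Measure E)
    [IsProbabilityMeasure Q] {e : κ → τ → ι} (he : Function.Injective fun p : κ × τ => e p.1 p.2)
    {φ : (τ → E) → ℝ} (hφ : Measurable φ) :
    ∫ x, ∏ j, φ (fun i => x (e j i)) ∂(Measure.pi fun _ : ι => Q)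
      = (∫ y, φ y ∂(Measure.pi fun _ : τ => Q)) ^ Fintype.card κ := by
  have h1 := map_comp_pi Q he
  have h2 : (Measure.pi fun _ : κ × τ => Q).map (MeasurableEquiv.curry κ τ E)
      = Measure.pi fun _ : κ => Measure.pi fun _ : τ => Q := by
    have := Measure.infinitePi_map_curry (ι := κ) (κ := τ) (fun _ _ => Q)
    simpa only [Measure.infinitePi_eq_pi] using this
  have hΦ : Measurable fun y : κ → τ → E => ∏ j, φ (y j) :=
    Finset.measurable_prod _ fun j _ => hφ.comp (measurable_pi_apply j)
  have hm : Measurable fun (x : ι → E) (p : κ × τ) => x (e p.1 p.2) :=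
    measurable_pi_lambda _ fun p => measurable_pi_apply _
  rw [← integral_fintype_prod_eq_pow φ, ← h2, ← h1,
    Measure.map_map (MeasurableEquiv.measurable _) hm,
    integral_map ((MeasurableEquiv.measurable _).comp hm).aemeasurable hΦ.aestronglyMeasurable]
  rfl

end Power

section Density

variable {α β : ProbabilityMeasure E}

lemma ae_density_pos (h : klDiv (β : Measure E) (α : Measure E) ≠ ∞) :
    ∀ᵐ x ∂(β : Measure E), 0 < density β α x := by
  filter_upwards [Measure.rnDeriv_pos (ac_of_klDiv_ne_top h),
    (ac_of_klDiv_ne_top h).ae_le (Measure.rnDeriv_lt_top (β : Measure E) (α : Measure E))]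
    with x h1 h2
  exact ENNReal.toReal_pos h1.ne' h2.ne

lemma integrable_log_density (h : klDiv (β : Measure E) (α : Measure E) ≠ ∞) :
    Integrable (fun x => Real.log (density β α x)) (β : Measure E) := (klDiv_ne_top_iff.1 h).2

lemma toReal_klDiv_eq_integral_log (h : klDiv (β : Measure E) (α : Measure E) ≠ ∞) :
    (klDiv (β : Measure E) (α : Measure E)).toReal
      = ∫ x, Real.log (density β α x) ∂(β : Measure E) :=
  toReal_klDiv_of_measure_eq (ac_of_klDiv_ne_top h) (by simp)

lemma powProb_eq_withDensity (h : klDiv (β : Measure E) (α : Measure E) ≠ ∞) (n : ℕ) :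
    (powProb n β : Measure (Fin n → E)) = (powProb n α : Measure (Fin n → E)).withDensity
      fun x => ENNReal.ofReal (∏ i, density β α (x i)) := by
  rw [coe_powProb]
  refine Measure.pi_eq fun s hs => ?_
  have hint : Integrable (fun x : Fin n → E => ∏ i, density β α (x i))
      (Measure.pi fun i => (α : Measure E).restrict (s i)) :=
    Integrable.fintype_prod fun i => integrable_density.integrableOn
  rw [withDensity_apply _ (MeasurableSet.univ_pi hs), coe_powProb, Measure.restrict_pi_pi,
    ← ofReal_integral_eq_lintegral_ofReal hint
      (ae_of_all _ fun _ => Finset.prod_nonneg fun _ _ => density_nonneg _),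
    integral_fintype_prod_eq_prod, ENNReal.ofReal_prod_of_nonneg fun _ _ =>
      integral_nonneg fun _ => density_nonneg _]
  refine Finset.prod_congr rfl fun i _ => ?_
  rw [setIntegral_density h, ofReal_measureReal]

lemma density_powProb (h : klDiv (β : Measure E) (α : Measure E) ≠ ∞) (n : ℕ) :
    density (powProb n β) (powProb n α) =ᵐ[(powProb n α : Measure (Fin n → E))]
      fun x => ∏ i, density β α (x i) :=
  density_withDensity
    (Finset.measurable_prod _ fun i _ => measurable_density.comp (measurable_pi_apply i))
    (fun _ => Finset.prod_nonneg fun _ _ => density_nonneg _) (powProb_eq_withDensity h n)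

lemma powProb_ac (h : klDiv (β : Measure E) (α : Measure E) ≠ ∞) (n : ℕ) :
    (powProb n β : Measure (Fin n → E)) ≪ (powProb n α : Measure (Fin n → E)) := by
  rw [powProb_eq_withDensity h]
  exact withDensity_absolutelyContinuous _ _

lemma log_density_powProb (h : klDiv (β : Measure E) (α : Measure E) ≠ ∞) {n : ℕ}
    {P : Measure (Fin n → E)} (hP : P ≪ (powProb n α : Measure (Fin n → E)))
    (hPβ : ∀ i, P.map (fun x => x i) ≪ (β : Measure E)) :
    ∀ᵐ x ∂P, density (powProb n β) (powProb n α) x = ∏ i, density β α (x i) ∧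
      (∀ i, 0 < density β α (x i)) ∧
      Real.log (density (powProb n β) (powProb n α) x) = ∑ i, Real.log (density β α (x i)) := by
  have hpos : ∀ᵐ x ∂P, ∀ i, 0 < density β α (x i) := by
    rw [ae_all_iff]
    intro i
    have h1 := (hPβ i).ae_le (ae_density_pos h)
    exact ae_of_ae_map (measurable_pi_apply i).aemeasurable h1
  filter_upwards [hP.ae_le (density_powProb h n), hpos] with x h1 h2
  refine ⟨h1, h2, ?_⟩
  rw [h1, Real.log_prod fun i _ => (h2 i).ne']

/-- Additivity of the relative entropy for product laws. -/
lemma klDiv_powProb (h : klDiv (β : Measure E) (α : Measure E) ≠ ∞) (n : ℕ) :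
    klDiv (powProb n β : Measure (Fin n → E)) (powProb n α : Measure (Fin n → E)) ≠ ∞ ∧
      (klDiv (powProb n β : Measure (Fin n → E)) (powProb n α : Measure (Fin n → E))).toReal
        = n * (klDiv (β : Measure E) (α : Measure E)).toReal := by
  have hlog := log_density_powProb h (powProb_ac h n)
    fun i => (map_eval_powProb β i).le.absolutelyContinuous
  have hi (i : Fin n) : Integrable (fun x : Fin n → E => Real.log (density β α (x i)))
      (powProb n β : Measure (Fin n → E)) :=
    integrable_comp_eval (μ := fun _ : Fin n => (β : Measure E)) (integrable_log_density h)
  have hsum : Integrable (fun x : Fin n → E => ∑ i, Real.log (density β α (x i)))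
      (powProb n β : Measure (Fin n → E)) := integrable_finsetSum _ fun i _ => hi i
  have hfin : klDiv (powProb n β : Measure (Fin n → E)) (powProb n α : Measure (Fin n → E)) ≠ ∞ :=
    klDiv_ne_top (powProb_ac h n)
      (hsum.congr (by filter_upwards [hlog] with x hx using hx.2.2.symm))
  refine ⟨hfin, ?_⟩
  rw [toReal_klDiv_eq_integral_log hfin,
    integral_congr_ae (g := fun x => ∑ i, Real.log (density β α (x i)))
      (by filter_upwards [hlog] with x hx using hx.2.2),
    integral_finsetSum _ fun i _ => hi i, toReal_klDiv_eq_integral_log h]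
  have (i : Fin n) : ∫ x : Fin n → E, Real.log (density β α (x i)) ∂(powProb n β : Measure _)
      = ∫ x, Real.log (density β α x) ∂(β : Measure E) := by
    conv_rhs => rw [← map_eval_powProb β i]
    exact (integral_map (measurable_pi_apply i).aemeasurable
      (Real.measurable_log.comp measurable_density).aestronglyMeasurable).symm
  simp [this]

/-- The entropic lower bound for the probability of an event: a change of measure to `β`, under
which the event is likely, costs the relative entropy. -/
lemma neg_mul_log_measureReal_le (h : klDiv (β : Measure E) (α : Measure E) ≠ ∞) (A : Set E) :
    -((β : Measure E).real A * Real.log ((α : Measure E).real A))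
      ≤ (klDiv (β : Measure E) (α : Measure E)).toReal + 1 := by
  set p := (α : Measure E).real A with hp
  set q := (β : Measure E).real A with hq
  have hkl : 0 ≤ (klDiv (β : Measure E) (α : Measure E)).toReal := ENNReal.toReal_nonneg
  have hq1 : q ≤ 1 := measureReal_le_one
  have hp1 : p ≤ 1 := measureReal_le_one
  have hp00 : 0 ≤ p := measureReal_nonneg
  have hq00 : 0 ≤ q := measureReal_nonneg
  rcases hp00.eq_or_lt with hp0 | hp0
  · rw [← hp0]; simp; positivity
  rcases hq00.eq_or_lt with hq0 | hq0
  · rw [← hq0]; simp; positivity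
  -- The tangent of `klFun` at the mean value `q / p` of the density on `A`.
  set z := q / p with hz
  have hz0 : 0 < z := by positivity
  have htan (x : ℝ) (hx : 0 ≤ x) : klFun z + Real.log z * (x - z) ≤ klFun x := by
    have h2 : 0 ≤ z * klFun (x / z) := mul_nonneg hz0.le (klFun_nonneg (by positivity))
    rw [mul_klFun_div hx hz0] at h2
    rw [klFun_apply, klFun_apply]
    linarith
  have hint : ∫ x in A, (klFun z + Real.log z * (density β α x - z)) ∂(α : Measure E)
      ≤ ∫ x in A, klFun (density β α x) ∂(α : Measure E) :=
    integral_mono ((integrable_const _).add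
      ((integrable_density.integrableOn.sub (integrable_const _)).const_mul _))
      (integrable_klFun_density h).integrableOn fun x => htan _ (density_nonneg x)
  have hle : ∫ x in A, klFun (density β α x) ∂(α : Measure E)
      ≤ (klDiv (β : Measure E) (α : Measure E)).toReal := by
    rw [toReal_klDiv_eq (ac_of_klDiv_ne_top h)]
    exact setIntegral_le_integral (integrable_klFun_density h)
      (ae_of_all _ fun x => klFun_nonneg (density_nonneg x))
  have hval : ∫ x in A, (klFun z + Real.log z * (density β α x - z)) ∂(α : Measure E)
      = p * klFun z := by
    have i1 : Integrable (fun x => density β α x - z) ((α : Measure E).restrict A) :=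
      integrable_density.integrableOn.sub (integrable_const _)
    rw [integral_add (integrable_const _) (i1.const_mul _), integral_const_mul,
      integral_sub integrable_density.integrableOn (integrable_const _),
      setIntegral_density h]
    simp only [integral_const, measureReal_restrict_apply_univ, smul_eq_mul]
    rw [← hp, ← hq, hz, mul_div_cancel₀ _ hp0.ne']
    ring
  rw [hval] at hint
  have hpz : p * klFun z = q * Real.log q - q * Real.log p + p - q := by
    rw [hz, mul_klFun_div hq00 hp0]
  have hqlog : q - 1 ≤ q * Real.log q := by
    have := klFun_nonneg hq0.le
    rw [klFun_apply] at this
    linarith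
  linarith

end Density

end

/-! ### Samples conditioned on a symmetric event -/

section

variable {E : Type*} [MeasurableSpace E]

section Conditioning

variable {R β : ProbabilityMeasure E} {A : Set E}

/-- The conditional probability given an event of positive probability. -/
def condProb (R : ProbabilityMeasure E) (A : Set E) (hA : (R : Measure E) A ≠ 0) :
    ProbabilityMeasure E :=
  ⟨ProbabilityTheory.cond (R : Measure E) A, cond_isProbabilityMeasure hA⟩

lemma coe_condProb (hA0 : (R : Measure E) A ≠ 0) :
    (condProb R A hA0 : Measure E) = ((R : Measure E) A)⁻¹ • (R : Measure E).restrict A := rfl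

lemma condProb_ac (hA0 : (R : Measure E) A ≠ 0) :
    (condProb R A hA0 : Measure E) ≪ (R : Measure E) :=
  cond_absolutelyContinuous

lemma ae_condProb_mem (hA : MeasurableSet A) (hA0 : (R : Measure E) A ≠ 0) :
    ∀ᵐ x ∂(condProb R A hA0 : Measure E), x ∈ A := by
  rw [coe_condProb]
  exact Measure.ae_smul_measure (ae_restrict_mem hA) _

lemma klDiv_condProb_ne_top (hA : MeasurableSet A) (hA0 : (R : Measure E) A ≠ 0) :
    klDiv (condProb R A hA0 : Measure E) (R : Measure E) ≠ ∞ := by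
  have hac := condProb_ac hA0
  refine klDiv_ne_top hac ((integrable_klFun_rnDeriv_iff hac).1 ?_)
  have hmeas : Measurable (A.indicator fun _ => ((R : Measure E) A)⁻¹) :=
    measurable_const.indicator hA
  have heq : (condProb R A hA0 : Measure E)
      = (R : Measure E).withDensity (A.indicator fun _ => ((R : Measure E) A)⁻¹) := by
    rw [withDensity_indicator hA, withDensity_const, coe_condProb]
  have hd := Measure.rnDeriv_withDensity (R : Measure E) hmeas
  rw [← heq] at hd
  -- The density takes two values, so that its image under `klFun` is bounded.
  refine Integrable.of_bound
    (measurable_klFun.comp (Measure.measurable_rnDeriv _ _).ennreal_toReal).aestronglyMeasurable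
    (|klFun 0| + |klFun (((R : Measure E) A)⁻¹).toReal|) ?_
  filter_upwards [hd] with x hx
  rw [hx, Real.norm_eq_abs]
  by_cases h : x ∈ A
  · rw [Set.indicator_of_mem h]
    linarith [abs_nonneg (klFun 0)]
  · rw [Set.indicator_of_notMem h, ENNReal.toReal_zero]
    linarith [abs_nonneg (klFun (((R : Measure E) A)⁻¹).toReal)]

/-- Jensen's inequality for `log (dβ/dR) + S` and the law `R` conditioned on `A`: the exponential
moment of `S` under `β` controls, at the cost `-log R(A)`, the conditional means of `S` and of the
logarithm `L` of the density of `β`, together. -/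
lemma integral_log_density_add_le (hA0 : (R : Measure E) A ≠ 0)
    (h : klDiv (β : Measure E) (R : Measure E) ≠ ∞) {L S : E → ℝ} {c : ℝ}
    (hL : ∀ᵐ x ∂(condProb R A hA0 : Measure E),
      0 < density β R x ∧ Real.log (density β R x) = L x)
    (hLi : Integrable L (condProb R A hA0 : Measure E)) (hS : Measurable S)
    (hSc : ∀ x, |S x| ≤ c) :
    ∫ x, L x ∂(condProb R A hA0 : Measure E) + ∫ x, S x ∂(condProb R A hA0 : Measure E)
      ≤ -Real.log ((R : Measure E).real A) + Real.log (∫ x, Real.exp (S x) ∂(β : Measure E)) := by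
  set P := condProb R A hA0 with hP
  set p := (R : Measure E).real A with hp
  set M := ∫ x, Real.exp (S x) ∂(β : Measure E) with hM
  have hp0 : 0 < p := ENNReal.toReal_pos hA0 (measure_ne_top _ _)
  have hexp_le (x : E) : Real.exp (S x) ≤ Real.exp c :=
    Real.exp_le_exp.2 ((le_abs_self _).trans (hSc x))
  have hexp_bound (x : E) : ‖Real.exp (S x)‖ ≤ Real.exp c := by
    rw [Real.norm_of_nonneg (Real.exp_pos _).le]
    exact hexp_le x
  have hexp_m : Measurable fun x => Real.exp (S x) := Real.measurable_exp.comp hS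
  have hM0 : 0 < M :=
    integral_exp_pos (Integrable.of_bound hexp_m.aestronglyMeasurable _ (ae_of_all _ hexp_bound))
  have hSi : Integrable S (P : Measure E) :=
    Integrable.of_bound hS.aestronglyMeasurable c (ae_of_all _ hSc)
  set G : E → ℝ := fun x => density β R x * Real.exp (S x) with hG
  have hG0 (x : E) : 0 ≤ G x := mul_nonneg (density_nonneg x) (Real.exp_pos _).le
  have hGi : Integrable G (R : Measure E) :=
    integrable_density.mul_bdd hexp_m.aestronglyMeasurable (ae_of_all _ hexp_bound)
  have hGM : ∫ x, G x ∂(R : Measure E) = M :=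
    integral_rnDeriv_smul (f := fun x => Real.exp (S x)) (ac_of_klDiv_ne_top h)
  have hGiP : Integrable G (P : Measure E) := by
    rw [hP, coe_condProb]
    exact hGi.integrableOn.smul_measure (ENNReal.inv_ne_top.2 hA0)
  have hGP : ∫ x, G x ∂(P : Measure E) ≤ M / p := by
    rw [hP, coe_condProb, integral_smul_measure, ENNReal.toReal_inv, smul_eq_mul, div_eq_inv_mul]
    refine mul_le_mul_of_nonneg_left ?_ (inv_nonneg.2 ENNReal.toReal_nonneg)
    rw [← hGM]
    exact setIntegral_le_integral hGi (ae_of_all _ hG0)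
  have hMp : 0 < M / p := by positivity
  have hint : ∫ x, (L x + S x) ∂(P : Measure E)
      ≤ ∫ x, ((M / p)⁻¹ * G x + (Real.log (M / p) - 1)) ∂(P : Measure E) := by
    refine integral_mono_ae (hLi.add hSi) ((hGiP.const_mul _).add (integrable_const _)) ?_
    filter_upwards [hL] with x hx
    have hGx : 0 < G x := mul_pos hx.1 (Real.exp_pos _)
    have h1 : L x + S x = Real.log (G x) := by
      rw [hG, Real.log_mul hx.1.ne' (Real.exp_pos _).ne', Real.log_exp, hx.2]
    have h2 := Real.log_le_sub_one_of_pos (show 0 < (M / p)⁻¹ * G x by positivity)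
    rw [Real.log_mul (by positivity) hGx.ne', Real.log_inv] at h2
    linarith
  rw [integral_add hLi hSi, integral_add (hGiP.const_mul _) (integrable_const _),
    integral_const_mul] at hint
  have h3 : (M / p)⁻¹ * ∫ x, G x ∂(P : Measure E) ≤ 1 := by
    rw [inv_mul_le_iff₀ hMp, mul_one]
    exact hGP
  have h4 : Real.log (M / p) = Real.log M - Real.log p := Real.log_div hM0.ne' hp0.ne'
  simp only [integral_const, probReal_univ, one_smul] at hint
  linarith

end Conditioning

section Exchangeability

lemma measurable_comp_right {ι κ : Type*} (f : κ → ι) :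
    Measurable fun (x : ι → E) (i : κ) => x (f i) :=
  measurable_pi_lambda _ fun _ => measurable_pi_apply _

variable {n k : ℕ} {α : ProbabilityMeasure E} {A : Set (Fin n → E)}

/-- Conditioning an i.i.d. sample on a permutation-invariant event gives an exchangeable law. -/
lemma map_perm_condProb (hA : MeasurableSet A)
    (hperm : ∀ (σ : Equiv.Perm (Fin n)) x, (fun i => x (σ i)) ∈ A ↔ x ∈ A)
    (hA0 : (powProb n α : Measure (Fin n → E)) A ≠ 0) (σ : Equiv.Perm (Fin n)) :
    (condProb (powProb n α) A hA0 : Measure (Fin n → E)).map (fun x i => x (σ i))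
      = condProb (powProb n α) A hA0 := by
  have hm : Measurable fun (x : Fin n → E) i => x (σ i) := measurable_comp_right σ
  have hinv : (powProb n α : Measure (Fin n → E)).map (fun x i => x (σ i)) = powProb n α :=
    map_comp_pi (α : Measure E) σ.injective
  rw [coe_condProb, Measure.map_smul]
  congr 1
  ext T hT
  rw [Measure.map_apply hm hT, Measure.restrict_apply (hm hT), Measure.restrict_apply hT]
  conv_rhs => rw [← hinv, Measure.map_apply hm (hT.inter hA)]
  congr 1
  ext x
  simp only [Set.mem_inter_iff, Set.mem_preimage, hperm σ x]

lemma map_comp_condProb_eq (hA : MeasurableSet A)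
    (hperm : ∀ (σ : Equiv.Perm (Fin n)) x, (fun i => x (σ i)) ∈ A ↔ x ∈ A)
    (hA0 : (powProb n α : Measure (Fin n → E)) A ≠ 0) {e e' : Fin k → Fin n}
    (he : e.Injective) (he' : e'.Injective) :
    (condProb (powProb n α) A hA0 : Measure (Fin n → E)).map (fun x i => x (e i))
      = (condProb (powProb n α) A hA0 : Measure (Fin n → E)).map (fun x i => x (e' i)) := by
  obtain ⟨σ, hσ⟩ := Equiv.Perm.exists_extending_pair e' e he' he
  conv_rhs => rw [← map_perm_condProb hA hperm hA0 σ]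
  rw [Measure.map_map (measurable_comp_right e') (measurable_comp_right σ)]
  congr 1
  funext x i
  simp only [Function.comp_apply]
  rw [← hσ i]

lemma map_eval_condProb_eq (hA : MeasurableSet A)
    (hperm : ∀ (σ : Equiv.Perm (Fin n)) x, (fun i => x (σ i)) ∈ A ↔ x ∈ A)
    (hA0 : (powProb n α : Measure (Fin n → E)) A ≠ 0) (i j : Fin n) :
    (condProb (powProb n α) A hA0 : Measure (Fin n → E)).map (fun x => x i)
      = (condProb (powProb n α) A hA0 : Measure (Fin n → E)).map (fun x => x j) := by
  conv_rhs => rw [← map_perm_condProb hA hperm hA0 (Equiv.swap i j)]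
  rw [Measure.map_map (measurable_pi_apply j) (measurable_comp_right (Equiv.swap i j))]
  congr 1
  funext x
  simp

lemma log_integral_exp_indicator_le {F : Type*} [MeasurableSpace F] (μ : Measure F)
    [IsProbabilityMeasure μ] {B : Set F} (hB : MeasurableSet B) {t : ℝ} (ht : |t| ≤ 1) :
    Real.log (∫ y, Real.exp (t * B.indicator 1 y) ∂μ) ≤ t * μ.real B + t ^ 2 := by
  have h1 (y : F) : Real.exp (t * B.indicator 1 y) = 1 + B.indicator 1 y * (Real.exp t - 1) := by
    by_cases hy : y ∈ B <;> simp [hy]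
  have hi : Integrable (fun y => B.indicator (1 : F → ℝ) y) μ :=
    (integrable_const (1 : ℝ)).indicator hB
  have h2 : ∫ y, Real.exp (t * B.indicator 1 y) ∂μ = 1 + μ.real B * (Real.exp t - 1) := by
    simp_rw [h1]
    rw [integral_add (integrable_const _) (hi.mul_const _), integral_mul_const,
      integral_indicator_one hB]
    simp
  have h3 : 0 < ∫ y, Real.exp (t * B.indicator 1 y) ∂μ := by
    refine integral_exp_pos ?_
    simp_rw [h1]
    exact (integrable_const _).add (hi.mul_const _)
  refine (Real.log_le_sub_one_of_pos h3).trans ?_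
  rw [h2]
  have h4 := abs_le.1 (Real.abs_exp_sub_one_sub_id_le ht)
  have h5 : μ.real B ≤ 1 := measureReal_le_one
  have h6 : 0 ≤ μ.real B := measureReal_nonneg
  nlinarith [sq_nonneg t]

/-- The key estimate. Under an i.i.d. sample conditioned on a symmetric event `A`, with marginal law
`β`, the entropy of `β` and the deviation of the law of `k` coordinates from `β^{⊗k}` are controlled
together by `-log P(A)`. The test function is the density of `β^{⊗n}` times the exponential of `t`
times the number of those among `n / k` disjoint blocks of `k` coordinates that lie in `B`. -/
lemma entropy_add_deviation_le [NeZero n] (hA : MeasurableSet A)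
    (hperm : ∀ (σ : Equiv.Perm (Fin n)) x, (fun i => x (σ i)) ∈ A ↔ x ∈ A)
    (hA0 : (powProb n α : Measure (Fin n → E)) A ≠ 0) {β : ProbabilityMeasure E}
    (hβ : ∀ i, (condProb (powProb n α) A hA0 : Measure (Fin n → E)).map (fun x => x i) = β)
    {e : Fin k → Fin n} (he : e.Injective) {B : Set (Fin k → E)} (hB : MeasurableSet B) {t : ℝ}
    (ht : |t| ≤ 1) :
    klDiv (β : Measure E) (α : Measure E) ≠ ∞ ∧
    n * (klDiv (β : Measure E) (α : Measure E)).toReal + (n / k : ℕ) * (t *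
      (((condProb (powProb n α) A hA0 : Measure (Fin n → E)).map (fun x i => x (e i))).real B
        - (powProb k β : Measure (Fin k → E)).real B))
      ≤ -Real.log ((powProb n α : Measure (Fin n → E)).real A) + (n / k : ℕ) * t ^ 2 := by
  have hfin : klDiv (β : Measure E) (α : Measure E) ≠ ∞ := by
    have h1 := klDiv_map_le (μ := (condProb (powProb n α) A hA0 : Measure (Fin n → E)))
      (ν := (powProb n α : Measure (Fin n → E))) (measurable_pi_apply (0 : Fin n))
    rw [hβ, map_eval_powProb] at h1
    exact ne_top_of_le_ne_top (klDiv_condProb_ne_top hA hA0) h1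
  refine ⟨hfin, ?_⟩
  set P := condProb (powProb n α) A hA0 with hP
  set m := n / k with hm
  let b : Fin m → Fin k → Fin n := fun j i => ⟨j * k + i, by
    have h1 : (j : ℕ) + 1 ≤ m := j.2
    have h2 : m * k ≤ n := Nat.div_mul_le_self n k
    have h3 := Nat.mul_le_mul_right k h1
    have h4 := i.2
    rw [add_mul, one_mul] at h3
    omega⟩
  have hb : Function.Injective fun q : Fin m × Fin k => b q.1 q.2 := by
    rintro ⟨j, i⟩ ⟨j', i'⟩ h
    have h1 : (j : ℕ) * k + i = j' * k + i' := congrArg Fin.val h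
    have hk0 : 0 < k := i.pos
    have h2 : (j : ℕ) = j' := by
      have := congrArg (· / k) h1
      simpa [Nat.mul_add_div, mul_comm _ k, Nat.div_eq_of_lt i.2, Nat.div_eq_of_lt i'.2, hk0]
        using this
    have h3 : (i : ℕ) = i' := by rw [h2] at h1; omega
    exact Prod.ext (Fin.ext h2) (Fin.ext h3)
  have hbj (j : Fin m) : (b j).Injective := fun i i' h => by
    have := hb (a₁ := (j, i)) (a₂ := (j, i')) h
    simpa using this
  have hcm (f : Fin k → Fin n) : Measurable fun (x : Fin n → E) i => x (f i) :=
    measurable_comp_right f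
  have hind : Measurable (B.indicator (1 : (Fin k → E) → ℝ)) := measurable_one.indicator hB
  set S : (Fin n → E) → ℝ := fun x => ∑ j : Fin m, t * B.indicator 1 (fun i => x (b j i)) with hS
  have hterm (j : Fin m) :
      Measurable fun x : Fin n → E => t * B.indicator (1 : (Fin k → E) → ℝ) (fun i => x (b j i)) :=
    (hind.comp (hcm (b j))).const_mul t
  have hSm : Measurable S := Finset.measurable_sum _ fun j _ => hterm j
  have hterm_le (j : Fin m) (x : Fin n → E) :
      |t * B.indicator (1 : (Fin k → E) → ℝ) (fun i => x (b j i))| ≤ 1 := by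
    by_cases hx : (fun i => x (b j i)) ∈ B <;> simp [hx, ht]
  have hSc (x) : |S x| ≤ m :=
    (Finset.abs_sum_le_sum_abs _ _).trans
      ((Finset.sum_le_sum fun j _ => hterm_le j x).trans (by simp))
  -- The mean of `S` under the conditional law, by exchangeability.
  have hSP : ∫ x, S x ∂(P : Measure (Fin n → E))
      = m * (t * ((P : Measure (Fin n → E)).map (fun x i => x (e i))).real B) := by
    rw [hS, integral_finsetSum _ fun j _ => Integrable.of_bound
      (hterm j).aestronglyMeasurable 1 (ae_of_all _ (hterm_le j))]
    have (j : Fin m) : ∫ x, t * B.indicator (1 : (Fin k → E) → ℝ) (fun i => x (b j i))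
          ∂(P : Measure (Fin n → E))
        = t * ((P : Measure (Fin n → E)).map (fun x i => x (e i))).real B := by
      rw [integral_const_mul, map_comp_condProb_eq hA hperm hA0 he (hbj j),
        ← integral_indicator_one hB,
        integral_map (hcm (b j)).aemeasurable hind.aestronglyMeasurable]
    simp [this]
  -- The exponential moment of `S` under `β^{⊗n}`, by independence of the blocks.
  have hSβ : ∫ x, Real.exp (S x) ∂(powProb n β : Measure (Fin n → E))
      = (∫ y, Real.exp (t * B.indicator 1 y) ∂(powProb k β : Measure (Fin k → E))) ^ m := by
    have h1 := integral_prod_blocks (β : Measure E) hb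
      (φ := fun y => Real.exp (t * B.indicator 1 y)) (Real.measurable_exp.comp (hind.const_mul t))
    rw [Fintype.card_fin] at h1
    rw [coe_powProb, coe_powProb, ← h1]
    refine integral_congr_ae (ae_of_all _ fun x => ?_)
    simp only [hS, Real.exp_sum]
  have hlog := log_density_powProb hfin (condProb_ac hA0) fun i => (hβ i).le.absolutelyContinuous
  have hLi (i : Fin n) : Integrable (fun x : Fin n → E => Real.log (density β α (x i)))
      (P : Measure (Fin n → E)) := by
    have h1 := integrable_log_density hfin
    rw [← hβ i] at h1
    exact h1.comp_measurable (measurable_pi_apply i)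
  have hLint : ∫ x, ∑ i, Real.log (density β α (x i)) ∂(P : Measure (Fin n → E))
      = n * (klDiv (β : Measure E) (α : Measure E)).toReal := by
    rw [integral_finsetSum _ fun i _ => hLi i, toReal_klDiv_eq_integral_log hfin]
    have (i : Fin n) : ∫ x, Real.log (density β α (x i)) ∂(P : Measure (Fin n → E))
        = ∫ x, Real.log (density β α x) ∂(β : Measure E) := by
      conv_rhs => rw [← hβ i]
      exact (integral_map (measurable_pi_apply i).aemeasurable
        (Real.measurable_log.comp measurable_density).aestronglyMeasurable).symm
    simp [this]
  have hmain := integral_log_density_add_le hA0 (klDiv_powProb hfin n).1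
    (L := fun x => ∑ i, Real.log (density β α (x i))) (S := S) (c := m)
    (by
      filter_upwards [hlog] with x hx
      exact ⟨by rw [hx.1]; exact Finset.prod_pos fun i _ => hx.2.1 i, hx.2.2⟩)
    (integrable_finsetSum _ fun i _ => hLi i) hSm hSc
  have h2 := log_integral_exp_indicator_le (powProb k β : Measure (Fin k → E)) hB ht
  rw [hLint, hSP, hSβ, Real.log_pow] at hmain
  have h3 := mul_le_mul_of_nonneg_left h2 (Nat.cast_nonneg (α := ℝ) m)
  linarith

end Exchangeability

end

/-! ### Lower bound for the probability of the enlargement -/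

section

variable {E : Type*} [MeasurableSpace E]

section ProductDistance

lemma powProb_succ_real {k : ℕ} (Q : ProbabilityMeasure E) {B : Set (Fin (k + 1) → E)}
    (hB : MeasurableSet B) :
    (powProb (k + 1) Q : Measure (Fin (k + 1) → E)).real B
      = ∫ x, (powProb k Q : Measure (Fin k → E)).real
          (Prod.mk x ⁻¹' ((MeasurableEquiv.piFinSuccAbove (fun _ => E) 0).symm ⁻¹' B))
          ∂(Q : Measure E) := by
  have hT := (MeasurableEquiv.piFinSuccAbove (fun _ : Fin (k + 1) => E) 0).symm.measurable hB
  have h := (measurePreserving_piFinSuccAbove (fun _ : Fin (k + 1) => (Q : Measure E)) 0).symm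
    (MeasurableEquiv.piFinSuccAbove (fun _ : Fin (k + 1) => E) 0)
  have h1 := h.measure_preimage_equiv B
  simp only [measureReal_def]
  rw [integral_toReal (measurable_measure_prodMk_left hT).aemeasurable
    (ae_of_all _ fun x => measure_lt_top _ _), coe_powProb, coe_powProb, ← h1,
    Measure.prod_apply hT]

/-- The total variation distance of `k`-fold powers is at most a multiple of that of the
factors. -/
lemma powProb_real_le {μ ν : ProbabilityMeasure E} {r : ℝ}
    (h : ∀ B, MeasurableSet B → (μ : Measure E).real B ≤ (ν : Measure E).real B + r) (k : ℕ)
    {B : Set (Fin k → E)} (hB : MeasurableSet B) :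
    (powProb k μ : Measure (Fin k → E)).real B
      ≤ (powProb k ν : Measure (Fin k → E)).real B + k * (2 * r) := by
  induction k with
  | zero =>
    have : (powProb 0 μ : Measure (Fin 0 → E)) = powProb 0 ν := by
      rw [coe_powProb, coe_powProb]
      exact (Measure.pi_of_empty _ isEmptyElim).trans (Measure.pi_of_empty _ isEmptyElim).symm
    rw [this]
    simp
  | succ k ih =>
    rw [powProb_succ_real μ hB, powProb_succ_real ν hB]
    set T := (MeasurableEquiv.piFinSuccAbove (fun _ : Fin (k + 1) => E) 0).symm ⁻¹' B with hT
    have hTm : MeasurableSet T :=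
      (MeasurableEquiv.piFinSuccAbove (fun _ : Fin (k + 1) => E) 0).symm.measurable hB
    have hmeas (Q : ProbabilityMeasure E) :
        Measurable fun x => (powProb k Q : Measure (Fin k → E)).real (Prod.mk x ⁻¹' T) :=
      (measurable_measure_prodMk_left hTm).ennreal_toReal
    have habs (Q : ProbabilityMeasure E) (x : E) :
        |(powProb k Q : Measure (Fin k → E)).real (Prod.mk x ⁻¹' T)| ≤ 1 := by
      rw [abs_of_nonneg measureReal_nonneg]
      exact measureReal_le_one
    have hint (Q R : ProbabilityMeasure E) :
        Integrable (fun x => (powProb k Q : Measure (Fin k → E)).real (Prod.mk x ⁻¹' T))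
          (R : Measure E) :=
      Integrable.of_bound (hmeas Q).aestronglyMeasurable 1 (ae_of_all _ (habs Q))
    have h1 : ∫ x, (powProb k μ : Measure (Fin k → E)).real (Prod.mk x ⁻¹' T) ∂(μ : Measure E)
        ≤ ∫ x, ((powProb k ν : Measure (Fin k → E)).real (Prod.mk x ⁻¹' T) + k * (2 * r))
          ∂(μ : Measure E) :=
      integral_mono (hint μ μ) ((hint ν μ).add (integrable_const _))
        fun x => ih (measurable_prodMk_left hTm)
    rw [integral_add (hint ν μ) (integrable_const _)] at h1
    have h2 := integral_sub_le_of_measureReal_le h (hmeas ν) (habs ν)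
    simp only [integral_const, probReal_univ, one_smul] at h1
    push_cast
    linarith

end ProductDistance

section LowerBound

variable {α αs : ProbabilityMeasure E} {K : Set E}

/-- The relative entropy of the law `αs` conditioned to stay in `K`. -/
lemma klDiv_condProb (h : klDiv (αs : Measure E) (α : Measure E) ≠ ∞) (hK : MeasurableSet K)
    (hK0 : (αs : Measure E) K ≠ 0) :
    klDiv (condProb αs K hK0 : Measure E) (α : Measure E) ≠ ∞ ∧
    (klDiv (condProb αs K hK0 : Measure E) (α : Measure E)).toReal
      = ((αs : Measure E).real K)⁻¹ * ∫ x in K, Real.log (density αs α x) ∂(αs : Measure E)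
        - Real.log ((αs : Measure E).real K) := by
  set Q := condProb αs K hK0 with hQ
  have ha : 0 < (αs : Measure E).real K := ENNReal.toReal_pos hK0 (measure_ne_top _ _)
  have hQs : (Q : Measure E) ≪ (αs : Measure E) := condProb_ac hK0
  have hQα : (Q : Measure E) ≪ (α : Measure E) := hQs.trans (ac_of_klDiv_ne_top h)
  have hlog : ∀ᵐ x ∂(Q : Measure E), Real.log (density Q α x)
      = Real.log (density αs α x) - Real.log ((αs : Measure E).real K) := by
    have h1 := Measure.rnDeriv_smul_left_of_ne_top ((αs : Measure E).restrict K) (α : Measure E)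
      (ENNReal.inv_ne_top.2 hK0)
    have h2 := Measure.rnDeriv_restrict (αs : Measure E) (α : Measure E) hK
    filter_upwards [hQα.ae_le h1, hQα.ae_le h2, hQs.ae_le (ae_density_pos h),
      ae_condProb_mem hK hK0] with x h1 h2 h3 h4
    have h5 : density Q α x = ((αs : Measure E).real K)⁻¹ * density αs α x := by
      rw [density, hQ, coe_condProb, h1, Pi.smul_apply, h2, Set.indicator_of_mem h4, smul_eq_mul,
        ENNReal.toReal_mul, ENNReal.toReal_inv]
      rfl
    rw [h5, Real.log_mul (inv_ne_zero ha.ne') h3.ne', Real.log_inv]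
    ring
  have hi : Integrable (fun x => Real.log (density αs α x)) (Q : Measure E) := by
    rw [hQ, coe_condProb]
    exact (integrable_log_density h).integrableOn.smul_measure (ENNReal.inv_ne_top.2 hK0)
  have hfin : klDiv (Q : Measure E) (α : Measure E) ≠ ∞ :=
    klDiv_ne_top hQα ((hi.sub (integrable_const (Real.log ((αs : Measure E).real K)))).congr
      (by filter_upwards [hlog] with x hx using hx.symm))
  refine ⟨hfin, ?_⟩
  rw [toReal_klDiv_eq_integral_log hfin, integral_congr_ae hlog,
    integral_sub hi (integrable_const _), hQ]
  simp only [integral_const, probReal_univ, one_smul]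
  rw [coe_condProb, integral_smul_measure, ENNReal.toReal_inv]
  rfl

variable [MetricSpace E] [SecondCountableTopology E] [BorelSpace E]
  {dbar : ProbabilityMeasure E → ProbabilityMeasure E → ℝ} {C : Set (ProbabilityMeasure E)}

/-- The bound on the probability that the empirical measure is far from the law of the sample,
for a law carried by the compact set `K`. -/
def deviationBound (K : Set E) (η : ℝ) (n : ℕ) : ℝ :=
  2 ^ (coveringNumber K (η / 8) + 1) * Real.exp (-(n * η ^ 2 / 8))

omit [SecondCountableTopology E] in
lemma IsAdmissible.dbar_condProb_le (hd : IsAdmissible dbar) (hK : MeasurableSet K)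
    (hK0 : (αs : Measure E) K ≠ 0) :
    dbar αs (condProb αs K hK0) ≤ 2 * (αs : Measure E).real Kᶜ := by
  refine hd.tv _ _ _ fun B hB => ?_
  have ha : 0 < (αs : Measure E).real K := ENNReal.toReal_pos hK0 (measure_ne_top _ _)
  have h1 : (condProb αs K hK0 : Measure E).real B
      = ((αs : Measure E).real K)⁻¹ * (αs : Measure E).real (K ∩ B) := by
    change (ProbabilityTheory.cond (αs : Measure E) K).real B = _
    rw [measureReal_def, cond_apply hK, ENNReal.toReal_mul, ENNReal.toReal_inv]
    rfl
  have h2 : (αs : Measure E).real (K ∩ B) ≤ (condProb αs K hK0 : Measure E).real B := by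
    rw [h1, inv_mul_eq_div, le_div_iff₀ ha]
    exact mul_le_of_le_one_right measureReal_nonneg measureReal_le_one
  have h3 : (αs : Measure E).real B
      ≤ (αs : Measure E).real (K ∩ B) + (αs : Measure E).real Kᶜ := by
    refine (measureReal_mono fun x hx => ?_).trans (measureReal_union_le _ _)
    by_cases hxK : x ∈ K
    · exact Or.inl ⟨hxK, hx⟩
    · exact Or.inr hxK
  linarith

/-- Lower bound for the probability that the empirical measure of a sample of law `α` lies in the
enlargement. The change of measure is to the law `αs` conditioned to stay in `K`. -/
lemma neg_log_empirical_le (hd : IsAdmissible dbar) (hC : C.Nonempty) (hαs : αs ∈ C)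
    (h : klDiv (αs : Measure E) (α : Measure E) ≠ ∞) (hK : IsCompact K)
    (hK0 : (αs : Measure E) K ≠ 0) {η ε : ℝ} (hη : 0 < η)
    (hε : ε = η + 2 * (αs : Measure E).real Kᶜ) (n : ℕ) [NeZero n]
    (hb : deviationBound K η n < 1) :
    (powProb n α : Measure (Fin n → E)) {x | empiricalProb x ∈ enlargement dbar C ε} ≠ 0 ∧
    (1 - deviationBound K η n) * -Real.log ((powProb n α : Measure (Fin n → E)).real
        {x | empiricalProb x ∈ enlargement dbar C ε})
      ≤ n * (((αs : Measure E).real K)⁻¹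
          * ∫ x in K, Real.log (density αs α x) ∂(αs : Measure E)
        - Real.log ((αs : Measure E).real K)) + 1 := by
  set A : Set (Fin n → E) := {x | empiricalProb x ∈ enlargement dbar C ε} with hA
  set Q := condProb αs K hK0 with hQ
  have hAm : MeasurableSet A := (isClosed_empiricalProb_mem hd hC n ε).measurableSet
  obtain ⟨hQfin, hQval⟩ := klDiv_condProb h hK.measurableSet hK0
  obtain ⟨hnfin, hnval⟩ := klDiv_powProb hQfin n
  have hQK : (Q : Measure E) Kᶜ = 0 := by
    have := ae_condProb_mem hK.measurableSet hK0
    rwa [ae_iff] at this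
  have hAc : (powProb n Q : Measure (Fin n → E)).real Aᶜ ≤ deviationBound K η n := by
    refine (measureReal_mono fun x hx => ?_).trans
      (measureReal_dbar_empiricalProb_gt_le hd hK hQK hη n)
    change η < _
    by_contra! hcon
    refine hx (mem_enlargement_of_le hd hαs ?_)
    have h1 := hd.triangle αs Q (empiricalProb x)
    have h2 := hd.dbar_condProb_le hK.measurableSet hK0
    rw [hε]
    linarith
  have hq : 1 - deviationBound K η n ≤ (powProb n Q : Measure (Fin n → E)).real A := by
    rw [probReal_compl_eq_one_sub hAm] at hAc
    linarith
  refine ⟨fun h0 => ?_, ?_⟩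
  · have h1 := powProb_ac hQfin n h0
    rw [measureReal_def, h1, ENNReal.toReal_zero] at hq
    linarith
  · have h1 := neg_mul_log_measureReal_le hnfin A
    rw [hnval, hQval] at h1
    have h2 : 0 ≤ -Real.log ((powProb n α : Measure (Fin n → E)).real A) :=
      neg_nonneg.2 (Real.log_nonpos measureReal_nonneg measureReal_le_one)
    have h3 := mul_le_mul_of_nonneg_right hq h2
    linarith

end LowerBound

section Asymptotics

variable [MetricSpace E] [SecondCountableTopology E] [BorelSpace E]
  {dbar : ProbabilityMeasure E → ProbabilityMeasure E → ℝ} {C : Set (ProbabilityMeasure E)}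
  {α αs : ProbabilityMeasure E} {K : ℕ → Set E} {η ε : ℕ → ℝ}

omit [SecondCountableTopology E] [BorelSpace E] [MeasurableSpace E] in
lemma eventually_pos_of_tendsto_atTop (hη_nonneg : ∀ n, 0 ≤ η n)
    (hηK : Tendsto (fun n : ℕ => (n : ℝ) * η n ^ 2
        + 8 * Real.log (η n) * (coveringNumber (K n) (η n / 8) : ℝ)) atTop atTop) :
    ∀ᶠ n in atTop, 0 < η n := by
  filter_upwards [hηK.eventually_gt_atTop 0] with n hn
  refine (hη_nonneg n).lt_of_ne fun h0 => ?_
  -- For `η n = 0` the expression vanishes, as `Real.log 0 = 0`.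
  rw [← h0] at hn
  simp at hn

omit [SecondCountableTopology E] [BorelSpace E] [MeasurableSpace E] in
lemma tendsto_deviationBound (hη_nonneg : ∀ n, 0 ≤ η n) (hη_zero : Tendsto η atTop (𝓝 0))
    (hηK : Tendsto (fun n : ℕ => (n : ℝ) * η n ^ 2
        + 8 * Real.log (η n) * (coveringNumber (K n) (η n / 8) : ℝ)) atTop atTop) :
    Tendsto (fun n => deviationBound (K n) (η n) n) atTop (𝓝 0) := by
  have hlim : Tendsto (fun n : ℕ => 2 * Real.exp (-(((n : ℝ) * η n ^ 2
        + 8 * Real.log (η n) * (coveringNumber (K n) (η n / 8) : ℝ)) / 8))) atTop (𝓝 0) := by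
    have := (Real.tendsto_exp_neg_atTop_nhds_zero.comp
      (hηK.atTop_div_const (show (0 : ℝ) < 8 by norm_num))).const_mul 2
    simpa using this
  refine squeeze_zero' (Eventually.of_forall fun n => by unfold deviationBound; positivity) ?_ hlim
  filter_upwards [eventually_pos_of_tendsto_atTop hη_nonneg hηK,
    hη_zero.eventually_le_const (show (0 : ℝ) < 1 / 2 by norm_num)] with n hn hn2
  set N := coveringNumber (K n) (η n / 8) with hN
  have hlog : Real.log (η n) ≤ -Real.log 2 := by
    rw [← Real.log_inv]
    exact Real.log_le_log hn (by linarith)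
  have h2 : (2 : ℝ) ^ N = Real.exp (N * Real.log 2) := by
    rw [mul_comm, Real.exp_mul, Real.exp_log two_pos, Real.rpow_natCast]
  rw [deviationBound, pow_succ, mul_comm _ (2 : ℝ), mul_assoc, ← hN, h2, ← Real.exp_add]
  gcongr
  have := mul_le_mul_of_nonneg_left hlog (Nat.cast_nonneg (α := ℝ) N)
  linarith

/-- The probability that the empirical measure lies in the enlargement is at least
`exp (-n (H(C | α) + o(1)))`. -/
lemma eventually_neg_log_empirical_le (hd : IsAdmissible dbar)
    (hent : relEntropy C α ≠ ∞) (hαs : IsIProjection C α αs) (hK : ∀ n, IsCompact (K n))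
    (hη_nonneg : ∀ n, 0 ≤ η n) (hη_zero : Tendsto η atTop (𝓝 0))
    (hηK : Tendsto (fun n : ℕ => (n : ℝ) * η n ^ 2
        + 8 * Real.log (η n) * (coveringNumber (K n) (η n / 8) : ℝ)) atTop atTop)
    (hε : ∀ n, ε n = η n + 2 * (αs : Measure E).real (K n)ᶜ)
    (hαK : Tendsto (fun n => (αs : Measure E).real (K n)) atTop (𝓝 1)) {δ : ℝ} (hδ : 0 < δ) :
    ∀ᶠ n : ℕ in atTop, ∀ [NeZero n],
      (powProb n α : Measure (Fin n → E)) {x | empiricalProb x ∈ enlargement dbar C (ε n)} ≠ 0 ∧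
      -Real.log ((powProb n α : Measure (Fin n → E)).real
          {x | empiricalProb x ∈ enlargement dbar C (ε n)})
        ≤ n * ((relEntropy C α).toReal + δ) := by
  have hfin : klDiv (αs : Measure E) (α : Measure E) ≠ ∞ := by rwa [hαs.2]
  have hlogi := integrable_log_density hfin
  have hcompl : Tendsto (fun n => (αs : Measure E) (K n)ᶜ) atTop (𝓝 0) := by
    have h1 : Tendsto (fun n => ENNReal.ofReal (1 - (αs : Measure E).real (K n))) atTop (𝓝 0) := by
      simpa using ENNReal.tendsto_ofReal (hαK.const_sub 1)
    refine h1.congr fun n => ?_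
    rw [← probReal_compl_eq_one_sub (hK n).measurableSet, ofReal_measureReal]
  have hint : Tendsto (fun n => ∫ x in K n, Real.log (density αs α x) ∂(αs : Measure E)) atTop
      (𝓝 (relEntropy C α).toReal) := by
    have h1 : Tendsto (fun n => ∫ x in (K n)ᶜ, Real.log (density αs α x) ∂(αs : Measure E)) atTop
        (𝓝 0) := hlogi.tendsto_setIntegral_nhds_zero hcompl
    have h2 := h1.const_sub (∫ x, Real.log (density αs α x) ∂(αs : Measure E))
    rw [sub_zero, ← toReal_klDiv_eq_integral_log hfin, hαs.2] at h2
    refine h2.congr fun n => ?_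
    rw [← hαs.2, toReal_klDiv_eq_integral_log hfin,
      ← integral_add_compl (hK n).measurableSet hlogi, add_sub_cancel_right]
  have hb := tendsto_deviationBound hη_nonneg hη_zero hηK
  have hlim : Tendsto (fun n : ℕ => ((((αs : Measure E).real (K n))⁻¹
      * ∫ x in K n, Real.log (density αs α x) ∂(αs : Measure E)
        - Real.log ((αs : Measure E).real (K n))) + 1 / (n : ℝ))
        / (1 - deviationBound (K n) (η n) n)) atTop (𝓝 (relEntropy C α).toReal) := by
    have h1 := (((hαK.inv₀ one_ne_zero).mul hint).sub
      ((Real.continuousAt_log one_ne_zero).tendsto.comp hαK)).add tendsto_one_div_atTop_nhds_zero_nat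
    have h2 := h1.div (hb.const_sub 1) (by norm_num)
    simpa [Pi.div_def] using h2
  filter_upwards [hlim.eventually_le_const (lt_add_of_pos_right _ hδ),
    hb.eventually_lt_const (show (0 : ℝ) < 1 by norm_num),
    hαK.eventually_const_lt (show (0 : ℝ) < 1 by norm_num),
    eventually_pos_of_tendsto_atTop hη_nonneg hηK] with n h1 h2 h3 h4 _
  have hK0 : (αs : Measure E) (K n) ≠ 0 := fun h0 => by
    rw [measureReal_def, h0, ENNReal.toReal_zero] at h3
    exact lt_irrefl _ h3
  obtain ⟨h5, h6⟩ := neg_log_empirical_le hd ⟨αs, hαs.1⟩ hαs.1 hfin (hK n) hK0 h4 (hε n) n h2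
  refine ⟨h5, ?_⟩
  have hn : (0 : ℝ) < n := Nat.cast_pos.2 (NeZero.pos n)
  have h7 : 0 < 1 - deviationBound (K n) (η n) n := sub_pos.2 h2
  rw [div_le_iff₀ h7] at h1
  have h8 := mul_le_mul_of_nonneg_left h1 hn.le
  rw [mul_add, mul_one_div_cancel hn.ne'] at h8
  refine le_of_mul_le_mul_left (h6.trans (h8.trans (le_of_eq ?_))) h7
  ring

end Asymptotics

end

/-! ### Convergence of the conditional laws -/

section

variable {E : Type*} [MeasurableSpace E]

section Marginals

variable {α : ProbabilityMeasure E} {n k : ℕ} [NeZero n] {A : Set (Fin n → E)}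

/-- The law of the first coordinate of a sample conditioned to lie in `A`. -/
def condMarginal (α : ProbabilityMeasure E) (A : Set (Fin n → E))
    (hA0 : (powProb n α : Measure (Fin n → E)) A ≠ 0) : ProbabilityMeasure E :=
  (condProb (powProb n α) A hA0).map (f := fun x => x 0) (measurable_pi_apply 0).aemeasurable

lemma map_eval_eq_condMarginal (hA : MeasurableSet A)
    (hperm : ∀ (σ : Equiv.Perm (Fin n)) x, (fun i => x (σ i)) ∈ A ↔ x ∈ A)
    (hA0 : (powProb n α : Measure (Fin n → E)) A ≠ 0) (i : Fin n) :
    (condProb (powProb n α) A hA0 : Measure (Fin n → E)).map (fun x => x i)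
      = condMarginal α A hA0 :=
  map_eval_condProb_eq hA hperm hA0 i 0

lemma condMarginal_eq_averageLaw (hA : MeasurableSet A)
    (hperm : ∀ (σ : Equiv.Perm (Fin n)) x, (fun i => x (σ i)) ∈ A ↔ x ∈ A)
    (hA0 : (powProb n α : Measure (Fin n → E)) A ≠ 0) :
    (condMarginal α A hA0 : Measure E)
      = averageLaw (condProb (powProb n α) A hA0 : Measure (Fin n → E)) fun i x => x i := by
  simp only [averageLaw, map_eval_eq_condMarginal hA hperm hA0, Finset.sum_const,
    Finset.card_univ, Fintype.card_fin]
  rw [← Nat.cast_smul_eq_nsmul ℝ≥0∞, smul_smul, ENNReal.inv_mul_cancel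
    (Nat.cast_ne_zero.2 (NeZero.ne n)) (ENNReal.natCast_ne_top n), one_smul]

/-- If the entropy of the marginal and the exponential rate of `A` differ by at most
`r ^ 2 / (2 * k)`, then blocks of `k` coordinates are nearly independent given `A`. -/
lemma abs_condProb_block_sub_le (hA : MeasurableSet A)
    (hperm : ∀ (σ : Equiv.Perm (Fin n)) x, (fun i => x (σ i)) ∈ A ↔ x ∈ A)
    (hA0 : (powProb n α : Measure (Fin n → E)) A ≠ 0) (hk : 0 < k) (hkn : k ≤ n)
    {e : Fin k → Fin n} (he : e.Injective) {h r : ℝ} (hr : 0 < r) (hr1 : r ≤ 1)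
    (hlow : h - r ^ 2 / (4 * k) ≤ (klDiv (condMarginal α A hA0 : Measure E) (α : Measure E)).toReal)
    (hrate : -Real.log ((powProb n α : Measure (Fin n → E)).real A)
      ≤ n * (h + r ^ 2 / (4 * k)))
    {B : Set (Fin k → E)} (hB : MeasurableSet B) :
    |((condProb (powProb n α) A hA0 : Measure (Fin n → E)).map (fun x i => x (e i))).real B
      - (powProb k (condMarginal α A hA0) : Measure (Fin k → E)).real B| ≤ 2 * r := by
  set D := ((condProb (powProb n α) A hA0 : Measure (Fin n → E)).map (fun x i => x (e i))).real B
      - (powProb k (condMarginal α A hA0) : Measure (Fin k → E)).real B with hD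
  have hk0 : (0 : ℝ) < k := Nat.cast_pos.2 hk
  have hq1 : (1 : ℝ) ≤ (n / k : ℕ) := by exact_mod_cast Nat.div_pos hkn hk
  -- As `k ≤ n`, the blocks cover at least half of the coordinates.
  have hn : (n : ℝ) ≤ 2 * k * (n / k : ℕ) := by
    have h1 : n < k * (n / k) + k := by
      conv_lhs => rw [← Nat.div_add_mod n k]
      exact Nat.add_lt_add_left (Nat.mod_lt _ hk) _
    have h2 : (n : ℝ) ≤ k * (n / k : ℕ) + k := by exact_mod_cast h1.le
    nlinarith
  have key (t : ℝ) (ht : |t| = r) : t * D ≤ 2 * r ^ 2 := by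
    have h1 := (entropy_add_deviation_le (k := k) hA hperm hA0
      (map_eval_eq_condMarginal hA hperm hA0) he hB (t := t) (ht.le.trans hr1)).2
    rw [← hD, ← sq_abs t, ht] at h1
    have h2 := mul_le_mul_of_nonneg_left hlow (Nat.cast_nonneg (α := ℝ) n)
    have h3 : (n / k : ℕ) * (t * D) ≤ n * (r ^ 2 / (2 * k)) + (n / k : ℕ) * r ^ 2 := by
      have : n * (r ^ 2 / (2 * k)) = n * (r ^ 2 / (4 * k)) + n * (r ^ 2 / (4 * k)) := by
        field_simp
        ring
      linarith
    have h4 : n * (r ^ 2 / (2 * k)) ≤ (n / k : ℕ) * r ^ 2 := by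
      refine (mul_le_mul_of_nonneg_right hn (by positivity)).trans (le_of_eq ?_)
      field_simp
    refine le_of_mul_le_mul_left ?_ (zero_lt_one.trans_le hq1)
    linarith
  have h1 := key r (abs_of_pos hr)
  have h2 := key (-r) (by rw [abs_neg, abs_of_pos hr])
  exact abs_le.2 ⟨by nlinarith, by nlinarith⟩

end Marginals

section Sampling

variable {Ω : Type*} [MeasurableSpace Ω] {P : Measure Ω}
  {α : ProbabilityMeasure E} {X : ℕ → Ω → E}

lemma map_sample_eq_powProb (hXmeas : ∀ i, Measurable (X i)) (hXindep : iIndepFun X P)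
    (hXlaw : ∀ i, P.map (X i) = (α : Measure E)) (n : ℕ) :
    P.map (fun ω (i : Fin n) => X i ω) = powProb n α := by
  have h : iIndepFun (fun i : Fin n => X i) P := hXindep.precomp Fin.val_injective
  rw [h.map_fun_eq_pi_map fun i : Fin n => (hXmeas i).aemeasurable, coe_powProb]
  simp only [hXlaw]

omit [MeasurableSpace Ω] in
lemma empiricalEvent_eq_preimage (X : ℕ → Ω → E) (n : ℕ) [NeZero n]
    (D : Set (ProbabilityMeasure E)) :
    empiricalEvent X n D
      = (fun ω (i : Fin n) => X i ω) ⁻¹' {x : Fin n → E | empiricalProb x ∈ D} := by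
  ext ω
  have h := coe_empiricalProb_eq_empiricalMeasure (n := n) fun i => X i ω
  constructor
  · rintro ⟨ν, hν, hνeq⟩
    have : ν = empiricalProb fun i : Fin n => X i ω :=
      ProbabilityMeasure.toMeasure_injective (hνeq.trans h.symm)
    rw [this] at hν
    exact hν
  · exact fun hω => ⟨_, hω, h⟩

lemma measure_empiricalEvent (hXmeas : ∀ i, Measurable (X i)) (hXindep : iIndepFun X P)
    (hXlaw : ∀ i, P.map (X i) = (α : Measure E)) {n : ℕ} [NeZero n]
    {D : Set (ProbabilityMeasure E)}
    (hD : MeasurableSet {x : Fin n → E | empiricalProb x ∈ D}) :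
    P (empiricalEvent X n D)
      = (powProb n α : Measure (Fin n → E)) {x | empiricalProb x ∈ D} := by
  rw [empiricalEvent_eq_preimage, ← map_sample_eq_powProb hXmeas hXindep hXlaw n,
    Measure.map_apply (measurable_pi_lambda _ fun i : Fin n => hXmeas i) hD]

lemma conditionalLaw_eq_map_condProb (hXmeas : ∀ i, Measurable (X i)) (hXindep : iIndepFun X P)
    (hXlaw : ∀ i, P.map (X i) = (α : Measure E)) {n k : ℕ} [NeZero n] (hkn : k ≤ n)
    {D : Set (ProbabilityMeasure E)}
    (hD : MeasurableSet {x : Fin n → E | empiricalProb x ∈ D})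
    (hD0 : (powProb n α : Measure (Fin n → E)) {x | empiricalProb x ∈ D} ≠ 0) :
    conditionalLaw P X n k D
      = (condProb (powProb n α) {x | empiricalProb x ∈ D} hD0 : Measure (Fin n → E)).map
          fun x i => x (Fin.castLE hkn i) := by
  have hm : Measurable fun ω (i : Fin n) => X i ω :=
    measurable_pi_lambda _ fun i : Fin n => hXmeas i
  rw [coe_condProb, ← measure_empiricalEvent hXmeas hXindep hXlaw hD,
    ← map_sample_eq_powProb hXmeas hXindep hXlaw n, Measure.restrict_map hm hD,
    ← empiricalEvent_eq_preimage, Measure.map_smul,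
    Measure.map_map (measurable_comp_right _) hm, ← Measure.map_smul]
  rfl

end Sampling

lemma tvDist_nonneg (μ ν : Measure E) : 0 ≤ tvDist μ ν :=
  Real.iSup_nonneg fun _ => abs_nonneg _

lemma tvDist_le {μ ν : Measure E} {r : ℝ}
    (h : ∀ B, MeasurableSet B → |μ.real B - ν.real B| ≤ r) : tvDist μ ν ≤ r := by
  have : Nonempty {B : Set E // MeasurableSet B} := ⟨⟨∅, MeasurableSet.empty⟩⟩
  exact ciSup_le fun B => h B.1 B.2

section Limit

variable [MetricSpace E] [SecondCountableTopology E] [BorelSpace E]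
  {dbar : ProbabilityMeasure E → ProbabilityMeasure E → ℝ} {C : Set (ProbabilityMeasure E)}
  {α αs : ProbabilityMeasure E} {ε : ℕ → ℝ}

/-- A lower bound `exp (-n (H(C | α) + o(1)))` for the probability that the empirical measure lies
in shrinking enlargements of `C` forces the conditioned coordinates to be asymptotically
independent of law the projection. -/
lemma eventually_condProb_close (hd : IsAdmissible dbar) (hclosed : IsClosed C)
    (hconv : IsConvexSet C) (hent : relEntropy C α ≠ ∞) (hαs : IsIProjection C α αs)
    (hε : Tendsto ε atTop (𝓝 0))
    (hrate : ∀ δ > 0, ∀ᶠ n : ℕ in atTop, ∀ [NeZero n],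
      (powProb n α : Measure (Fin n → E)) {x | empiricalProb x ∈ enlargement dbar C (ε n)} ≠ 0 ∧
      -Real.log ((powProb n α : Measure (Fin n → E)).real
          {x | empiricalProb x ∈ enlargement dbar C (ε n)})
        ≤ n * ((relEntropy C α).toReal + δ))
    {k : ℕ} (hk : 0 < k) {r : ℝ} (hr : 0 < r) (hr1 : r ≤ 1) :
    ∀ᶠ n : ℕ in atTop, ∀ [NeZero n] (hA0 : (powProb n α : Measure (Fin n → E))
        {x | empiricalProb x ∈ enlargement dbar C (ε n)} ≠ 0) (e : Fin k → Fin n),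
      e.Injective → ∀ B : Set (Fin k → E), MeasurableSet B →
      |((condProb (powProb n α) {x | empiricalProb x ∈ enlargement dbar C (ε n)} hA0 :
          Measure (Fin n → E)).map fun x i => x (e i)).real B
        - (powProb k αs : Measure (Fin k → E)).real B| ≤ 2 * r + k * (2 * r) := by
  have hC : C.Nonempty := ⟨αs, hαs.1⟩
  have hδ : 0 < r ^ 2 / (4 * (k : ℝ)) := by
    have : (0 : ℝ) < k := Nat.cast_pos.2 hk
    positivity
  obtain ⟨ε₁, hε₁, hlow⟩ := exists_enlargement_entropy_ge (α := α) hd hC hclosed hconv hδ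
  obtain ⟨ε₂, hε₂, hclose⟩ := exists_enlargement_close_to_projection hd hclosed hconv hent hαs hr
  filter_upwards [hrate _ (lt_min hδ hε₂), hε.eventually_le_const (lt_min hε₁ hε₂),
    eventually_ge_atTop k] with n hn hεn hkn _ hA0 e he B hB
  have hA := (isClosed_empiricalProb_mem hd hC n (ε n)).measurableSet
  have hperm (σ : Equiv.Perm (Fin n)) (x : Fin n → E) :
      (fun i => x (σ i)) ∈ {x : Fin n → E | empiricalProb x ∈ enlargement dbar C (ε n)}
        ↔ x ∈ {x : Fin n → E | empiricalProb x ∈ enlargement dbar C (ε n)} := by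
    change empiricalProb (fun i => x (σ i)) ∈ enlargement dbar C (ε n)
      ↔ empiricalProb x ∈ enlargement dbar C (ε n)
    rw [empiricalProb_comp_perm]
  set A : Set (Fin n → E) := {x | empiricalProb x ∈ enlargement dbar C (ε n)} with hAdef
  set β := condMarginal α A hA0 with hβ
  have hn0 : (0 : ℝ) < n := Nat.cast_pos.2 (NeZero.pos n)
  have hβmem : β ∈ enlargement dbar C (ε n) :=
    barycenter_mem_enlargement hd hC hconv (condProb (powProb n α) A hA0 : Measure (Fin n → E))
      (ae_condProb_mem hA hA0) (condMarginal_eq_averageLaw hA hperm hA0)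
  have hβ1 := enlargement_mono (hεn.trans (min_le_left _ _)) hβmem
  have hβ2 := enlargement_mono (hεn.trans (min_le_right _ _)) hβmem
  obtain ⟨hβfin, hβent⟩ := entropy_add_deviation_le (k := k) hA hperm hA0
    (map_eval_eq_condMarginal hA hperm hA0) he hB (t := 0) (by simp)
  have hβle : (klDiv (β : Measure E) (α : Measure E)).toReal
      ≤ (relEntropy C α).toReal + min (r ^ 2 / (4 * (k : ℝ))) ε₂ := by
    refine le_of_mul_le_mul_left (le_trans ?_ hn.2) hn0
    simpa using hβent
  have hβαs := hclose β hβ2 hβfin (hβle.trans (by gcongr; exact min_le_right _ _))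
  have h1 := abs_condProb_block_sub_le hA hperm hA0 hk hkn he hr hr1
    (hlow β hβ1 hβfin) (hn.2.trans (by gcongr; exact min_le_left _ _)) hB
  have h2 := powProb_real_le (μ := β) (ν := αs) (r := r)
    (fun B _ => by linarith [(abs_le.1 (hβαs B)).2]) k hB
  have h3 := powProb_real_le (μ := αs) (ν := β) (r := r)
    (fun B _ => by linarith [(abs_le.1 (hβαs B)).1]) k hB
  rw [abs_le] at h1 ⊢
  constructor <;> linarith [h1.1, h1.2]

end Limit

end

end ThinConstraints

end

open ThinConstraints
theorem theorem4p8
    {E : Type*} [MetricSpace E] [PolishSpace E] [MeasurableSpace E] [BorelSpace E]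
    {Ω : Type*} [MeasurableSpace Ω] (P : Measure Ω) [IsProbabilityMeasure P]
    (α : ProbabilityMeasure E)
    (X : ℕ → Ω → E) (hXmeas : ∀ i, Measurable (X i)) (hXindep : iIndepFun X P)
    (hXlaw : ∀ i, P.map (X i) = (α : Measure E))
    (dbar : ProbabilityMeasure E → ProbabilityMeasure E → ℝ)
    (hdbar : dbar = prohorovDist ∨ dbar = fortetMourierDist)
    (C : Set (ProbabilityMeasure E)) (hCclosed : IsClosed C) (hCconvex : IsConvexSet C)
    (hCent : relEntropy C α < ∞)
    (αs : ProbabilityMeasure E) (hαs : IsIProjection C α αs)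
    (K : ℕ → Set E) (hK : ∀ n, IsCompact (K n))
    (η : ℕ → ℝ) (hη_nonneg : ∀ n, 0 ≤ η n) (hη_zero : Tendsto η atTop (𝓝 0))
    (hηK : Tendsto
      (fun n : ℕ => (n : ℝ) * η n ^ 2
        + 8 * Real.log (η n) * (coveringNumber (K n) (η n / 8) : ℝ)) atTop atTop)
    (ε : ℕ → ℝ) (hε : ∀ n, ε n = η n + 2 * (αs : Measure E).real (K n)ᶜ)
    (hcase :
      Tendsto (fun n : ℕ => ((αs : Measure E).real (K n)) ^ n) atTop (𝓝 1) ∨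
      ((∃ h : E →ᵇ ℝ, (αs : Measure E) =
          (α : Measure E).withDensity (fun x => ENNReal.ofReal (Real.exp (h x)))) ∧
        Tendsto (fun n : ℕ => (αs : Measure E).real (K n)) atTop (𝓝 1)))
    (k : ℕ) (hk : 0 < k) :
    (∀ᶠ n : ℕ in atTop, 0 < P (empiricalEvent X n (enlargement dbar C (ε n)))) ∧
    Tendsto
      (fun n : ℕ => tvDist (conditionalLaw P X n k (enlargement dbar C (ε n)))
        (Measure.pi (fun _ : Fin k => (αs : Measure E))))
      atTop (𝓝 0) := by
  have hd : IsAdmissible dbar := by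
    rcases hdbar with rfl | rfl
    · exact isAdmissible_prohorovDist
    · exact isAdmissible_fortetMourierDist
  have hC : C.Nonempty := ⟨αs, hαs.1⟩
  have hαK : Tendsto (fun n => (αs : Measure E).real (K n)) atTop (𝓝 1) := by
    rcases hcase with h | h
    · -- For `n ≥ 1` a number of `[0, 1]` is at least its `n`-th power.
      refine tendsto_of_tendsto_of_tendsto_of_le_of_le' h tendsto_const_nhds ?_
        (Eventually.of_forall fun n => measureReal_le_one)
      filter_upwards [eventually_ge_atTop 1] with n hn
      exact pow_le_of_le_one measureReal_nonneg measureReal_le_one (Nat.one_le_iff_ne_zero.1 hn)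
    · exact h.2
  have hε0 : Tendsto ε atTop (𝓝 0) := by
    have h := hη_zero.add ((hαK.const_sub 1).const_mul 2)
    rw [sub_self, mul_zero, add_zero] at h
    refine h.congr fun n => ?_
    rw [hε, probReal_compl_eq_one_sub (hK n).measurableSet]
  have hrate (δ : ℝ) (hδ : 0 < δ) :=
    eventually_neg_log_empirical_le hd hCent.ne hαs hK hη_nonneg hη_zero hηK hε hαK hδ
  refine ⟨?_, ?_⟩
  · filter_upwards [hrate 1 one_pos, eventually_ge_atTop 1] with n hn hn1
    have : NeZero n := ⟨Nat.one_le_iff_ne_zero.1 hn1⟩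
    rw [measure_empiricalEvent hXmeas hXindep hXlaw
      (isClosed_empiricalProb_mem hd hC n (ε n)).measurableSet]
    exact pos_iff_ne_zero.2 hn.1
  · refine tendsto_order.2 ⟨fun a ha => Eventually.of_forall fun n =>
      ha.trans_le (tvDist_nonneg _ _), fun a ha => ?_⟩
    have hk0 : (0 : ℝ) < k := Nat.cast_pos.2 hk
    have hr : 0 < min 1 (a / (2 + 2 * k) / 2) := by positivity
    filter_upwards [eventually_condProb_close hd hCclosed hCconvex hCent.ne hαs hε0 hrate hk hr
      (min_le_left _ _), hrate 1 one_pos, eventually_ge_atTop k] with n hn hn0 hkn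
    have : NeZero n := ⟨(hk.trans_le hkn).ne'⟩
    have hA0 := hn0.1
    rw [conditionalLaw_eq_map_condProb hXmeas hXindep hXlaw hkn
      (isClosed_empiricalProb_mem hd hC n (ε n)).measurableSet hA0, ← coe_powProb]
    refine (tvDist_le (hn hA0 _ (Fin.castLE_injective hkn))).trans_lt ?_
    have h1 := min_le_right 1 (a / (2 + 2 * k) / 2)
    have h2 : (2 + 2 * k) * (a / (2 + 2 * (k : ℝ)) / 2) = a / 2 := by field_simp
    have h3 := mul_le_mul_of_nonneg_left h1 (show (0 : ℝ) ≤ 2 + 2 * k by positivity)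
    linarith
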